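/- Let $n\in\mathbb N$ and let $c_i=\sigma_3^{\otimes (i-1)}\otimes\sigma^-\otimes I_2^{\otimes(n-i)}$, $c_i^\dagger=\sigma_3^{\otimes (i-1)}\otimes\sigma^+\otimes I_2^{\otimes(n-i)}$ ($1\le i\le n$) be the fermionic annihilation and creation operators on $(\mathbb C^2)^{\otimes n}$, where $\sigma_3=\begin{pmatrix}1&0\\0&-1\end{pmatrix}$, $\sigma^-=\begin{pmatrix}0&0\\1&0\end{pmatrix}$, $\sigma^+=\begin{pmatrix}0&1\\0&0\end{pmatrix}$. Put $\mathfrak c=(c_1,\dots,c_n,c_1^\dagger,\dots,c_n^\dagger)^T$, $P=\sigma_3^{\otimes n}$, $E=\begin{pmatrix}0&I_n\\I_n&0\end{pmatrix}$, $\tilde K=E\overline KE$ and $\mathfrak c^TK\mathfrak c=\sum_{i,j}K_{ij}\mathfrak c_i\mathfrak c_j$ for $K\in\mathbb C^{2n\times 2n}$. For a density matrix $\rho$ let $D=\bigl(\mathrm{tr}(\mathfrak c_i\mathfrak c_j\rho)\bigr)_{i,j}$ be its matrix of second moments and $A=(D-D^T)/2$ its anticovariance matrix. Let $\boldsymbol\theta=(\theta_1,\dots,\theta_n,\overline\theta_1,\dots,\overline\theta_n)^T$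 be Grassmann variables which anticommute with each other and with all $c_i,c_i^\dagger$. A density matrix $\rho$ is an even Gaussian state if its characteristic function has the form $\mathrm{tr}(\rho\,e^{\boldsymbol\theta^TE\mathfrak c})=e^{\frac12\boldsymbol\theta^TK\boldsymbol\theta}$ for some $K=-K^T\in\mathbb C^{2n\times2n}$. A linear map $\Phi$ on operators on $(\mathbb C^2)^{\otimes n}$ is called a parity-preserving Gaussian fermionic channel characterized by the pair $(G,\alpha)$ of $2n\times2n$ matrices if it is completely positive and trace preserving, satisfies $\Phi(PXP)=P\Phi(X)P$ for all operators $X$, maps even Gaussian states to even Gaussian states, and transforms the anticovariance matrix of every density matrix by $A'=GAG^T+\alpha$. **Proposition.** Let $H,\Gamma\in\mathbb C^{2n\times2n}$ satisfy $H=-H^T=-\tilde H$, $\Gamma^T=\tilde\Gamma$ and $\Gamma E\geqslant0$, and let $$\mathcal L_{H,\Gamma,0}(\rho)=-i\Bigl[\tfrac12\mathfrak c^TH\mathfrak c,\rho\Bigr]+\sum_{i,j}\Gamma_{ij}\,\mathfrak c_i\,\rho\,\mathfrak c_j-\tfrac12\,\mathfrak c^T\Gamma^T\mathfrak c\,\rho-\tfrac12\,\rho\,\mathfrak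 c^T\Gamma^T\mathfrak c .$$ If the matrix $iH-\frac{\Gamma^T+\Gamma}2$ is non-degenerate, then for every $t\ge0$ the map $e^{\mathcal L_{H,\Gamma,0}t}$ is a parity-preserving Gaussian fermionic channel, characterized by the pair $$G_t=e^{E\left(-iH-\frac{\Gamma^T+\Gamma}2\right)t},\qquad \alpha_t=\int_0^te^{E\left(-iH-\frac{\Gamma^T+\Gamma}2\right)t'}\,E\,\frac{\Gamma^T-\Gamma}2\,E\,e^{\left(iH-\frac{\Gamma^T+\Gamma}2\right)Et'}\,dt'.$$ -/

import Mathlib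

open Matrix
open scoped ComplexOrder

namespace FermiGauss

/-! ### The `n`-mode fermionic space `⊗_{j=1}^n ℂ²` -/

/-- Labels of the standard product basis of `⊗_{j=1}^n ℂ²`. -/
abbrev Conf (n : ℕ) : Type := Fin n → Fin 2

/-- Operators on `⊗_{j=1}^n ℂ² = ℂ^(2^n)`, as matrices in the standard product basis. -/
abbrev Op (n : ℕ) : Type := Matrix (Conf n) (Conf n) ℂ

/-- Index set of the `2n` operators `c_1, …, c_n, c_1†, …, c_n†`. -/
abbrev Idx (n : ℕ) : Type := Fin n ⊕ Fin n

/-- `2n × 2n` complex matrices. -/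
abbrev Mat (n : ℕ) : Type := Matrix (Idx n) (Idx n) ℂ

/-- The tensor (Kronecker) product `M_1 ⊗ ⋯ ⊗ M_n` of `2 × 2` matrices. -/
def tensor {n : ℕ} (M : Fin n → Matrix (Fin 2) (Fin 2) ℂ) : Op n :=
  Matrix.of fun x y => ∏ j, M j (x j) (y j)

def sigma3 : Matrix (Fin 2) (Fin 2) ℂ := !![1, 0; 0, -1]

def sigmaMinus : Matrix (Fin 2) (Fin 2) ℂ := !![0, 0; 1, 0]

def sigmaPlus : Matrix (Fin 2) (Fin 2) ℂ := !![0, 1; 0, 0]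

/-- `σ_3 ⊗ ⋯ ⊗ σ_3 ⊗ s ⊗ I_2 ⊗ ⋯ ⊗ I_2` with `s` in position `i`. -/
def jordanWigner {n : ℕ} (s : Matrix (Fin 2) (Fin 2) ℂ) (i : Fin n) : Op n :=
  tensor fun j => if j < i then sigma3 else if j = i then s else 1

/-- The vector `𝔠 = (c_1, …, c_n, c_1†, …, c_n†)` of annihilation and creation operators. -/
def cc {n : ℕ} : Idx n → Op n :=
  Sum.elim (jordanWigner sigmaMinus) (jordanWigner sigmaPlus)

/-- The fermionic parity operator `σ_3 ⊗ ⋯ ⊗ σ_3`. -/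
def parity (n : ℕ) : Op n := tensor fun _ => sigma3

/-- The linear form `f^T 𝔠`. -/
def linForm {n : ℕ} (f : Idx n → ℂ) : Op n := ∑ i, f i • cc i

/-- The quadratic form `𝔠^T K 𝔠`. -/
def quadForm {n : ℕ} (K : Mat n) : Op n := ∑ i, ∑ j, K i j • (cc i * cc j)

/-- The block matrix `E = [[0, I_n], [I_n, 0]]`. -/
def matE (n : ℕ) : Mat n := Matrix.fromBlocks 0 1 1 0

/-- The `∼`-conjugation `E K̄ E` of matrices, `K̄` being the elementwise complex conjugate. -/
def tildeConj {n : ℕ} (K : Mat n) : Mat n := matE n * K.map star * matE n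

/-! ### States -/

/-- Density matrices: self-adjoint, non-negative, of trace one. -/
def IsDensity {n : ℕ} (ρ : Op n) : Prop := ρ.PosSemidef ∧ ρ.trace = 1

/-- The matrix of second moments `D = tr (𝔠 𝔠^T ρ)`. -/
def secondMoments {n : ℕ} (ρ : Op n) : Mat n :=
  Matrix.of fun i j => (cc i * cc j * ρ).trace

/-- The anticovariance matrix `A = (D - D^T) / 2`. -/
noncomputable def anticov {n : ℕ} (ρ : Op n) : Mat n :=
  (1 / 2 : ℂ) • (secondMoments ρ - (secondMoments ρ)ᵀ)

/-! ### Grassmann variables, characteristic functions, Gaussian states -/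

/-- The Grassmann algebra with the `2n` generators `θ_1, …, θ_n, θ̄_1, …, θ̄_n`. -/
abbrev Grass (n : ℕ) : Type := ExteriorAlgebra ℂ (Idx n → ℂ)

/-- The generators `𝛉 = (θ_1, …, θ_n, θ̄_1, …, θ̄_n)`. -/
noncomputable def theta {n : ℕ} (i : Idx n) : Grass n :=
  ExteriorAlgebra.ι ℂ (Pi.single i 1)

/-- The matrix representation of the algebra generated by the CAR algebra and the Grassmann
variables: matrices with entries in the Grassmann algebra. -/
abbrev CARGrass (n : ℕ) : Type := Matrix (Conf n) (Conf n) (Grass n)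

/-- An operator on `ℂ^(2^n)`, as an element of the CAR-Grassmann algebra. -/
noncomputable def liftOp {n : ℕ} (X : Op n) : CARGrass n := X.map (algebraMap ℂ (Grass n))

/-- The Grassmann variable `θ_i`, as an element of the CAR-Grassmann algebra. The parity operator
makes it anticommute with all `c_j` and `c_j†` (and with all other Grassmann variables). -/
noncomputable def liftTheta {n : ℕ} (i : Idx n) : CARGrass n :=
  Matrix.of fun x y => parity n x y • theta i

/-- `𝛉^T E 𝔠`. -/
noncomputable def thetaEc (n : ℕ) : CARGrass n :=
  ∑ i, ∑ j, matE n i j • (liftTheta i * liftOp (cc j))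

/-- The characteristic function `tr (ρ e^{𝛉^T E 𝔠})`, an element of the Grassmann algebra; the trace
is the partial trace over `ℂ^(2^n)`, and the exponential is the finite exponential sum of a nilpotent
element. -/
noncomputable def charFun {n : ℕ} (ρ : Op n) : Grass n :=
  (liftOp ρ * IsNilpotent.exp (thetaEc n)).trace

/-- The Gaussian exponential `e^{𝛉^T K 𝛉 / 2}` in the Grassmann algebra. -/
noncomputable def gaussExp {n : ℕ} (K : Mat n) : Grass n :=
  IsNilpotent.exp ((1 / 2 : ℂ) • ∑ i, ∑ j, K i j • (theta i * theta j))

/-- Even Gaussian states: the characteristic function is the exponential of a quadratic form. -/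
def IsEvenGaussian {n : ℕ} (ρ : Op n) : Prop :=
  IsDensity ρ ∧ ∃ K : Mat n, Kᵀ = -K ∧ charFun ρ = gaussExp K

/-! ### The quadratic generator and its exponential -/

/-- `𝓛_{H,Γ,f}(ρ) = -i[𝔠^T H 𝔠 / 2 + f^T 𝔠, ρ] + 𝔠^T ρ Γ 𝔠 - 𝔠^T Γ^T 𝔠 ρ / 2 - ρ 𝔠^T Γ^T 𝔠 / 2`,
where `𝔠^T ρ Γ 𝔠 = ∑ Γ_ij c_i ρ c_j`. -/
noncomputable def quadGen {n : ℕ} (H Γ : Mat n) (f : Idx n → ℂ) : Op n →ₗ[ℂ] Op n where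
  toFun ρ :=
    -Complex.I • (((1 / 2 : ℂ) • quadForm H + linForm f) * ρ
        - ρ * ((1 / 2 : ℂ) • quadForm H + linForm f))
      + ∑ i, ∑ j, Γ i j • (cc i * ρ * cc j)
      - (1 / 2 : ℂ) • (quadForm Γᵀ * ρ)
      - (1 / 2 : ℂ) • (ρ * quadForm Γᵀ)
  map_add' ρ ρ' := by
    simp only [mul_add, add_mul, smul_add, smul_sub, Finset.sum_add_distrib]
    abel
  map_smul' a ρ := by
    have h : ∑ i, ∑ j, Γ i j • (cc i * (a • ρ) * cc j)
        = a • ∑ i, ∑ j, Γ i j • (cc i * ρ * cc j) := by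
      simp only [Finset.smul_sum, Matrix.mul_smul, Matrix.smul_mul]
      exact Finset.sum_congr rfl fun i _ => Finset.sum_congr rfl fun j _ => smul_comm _ _ _
    rw [h]
    simp only [Matrix.mul_smul, Matrix.smul_mul, RingHom.id_apply, smul_add, smul_sub,
      smul_comm a]

section Channels

/- The norm fixes the Banach algebra of superoperators (all norms are equivalent), the order is the
Loewner order: `0 ≤ X` iff `X` is positive semidefinite. -/
open scoped Matrix.Norms.L2Operator MatrixOrder

/-- The superoperator `e^{𝓛 t}`. -/
noncomputable def superExp {n : ℕ} (L : Op n →ₗ[ℂ] Op n) (t : ℝ) : Op n →ₗ[ℂ] Op n :=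
  (NormedSpace.exp ((t : ℂ) • LinearMap.toContinuousLinearMap L) : Op n →L[ℂ] Op n)

/-- Quantum channels: completely positive trace-preserving linear maps. -/
def IsChannel {n : ℕ} (Φ : Op n →ₗ[ℂ] Op n) : Prop :=
  (∃ Ψ : CompletelyPositiveMap (Op n) (Op n), Ψ.toLinearMap = Φ) ∧
    ∀ X : Op n, (Φ X).trace = X.trace

end Channels

/-- `Φ` is a parity-preserving Gaussian fermionic channel with the pair `(G, α)`: it is a channel, it
is covariant under the parity automorphism `X ↦ P X P` (so it maps even operators to even and odd ones
to odd ones), it maps even Gaussian states to even Gaussian states, and it transforms the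
anticovariance matrix of every state by `A' = G A G^T + α`. -/
structure IsParityPreservingGaussianChannel {n : ℕ} (Φ : Op n →ₗ[ℂ] Op n) (G α : Mat n) :
    Prop where
  channel : IsChannel Φ
  parity_preserving : ∀ X : Op n, Φ (parity n * X * parity n) = parity n * Φ X * parity n
  gaussian : ∀ ρ : Op n, IsEvenGaussian ρ → IsEvenGaussian (Φ ρ)
  moments : ∀ ρ : Op n, IsDensity ρ → anticov (Φ ρ) = G * anticov ρ * Gᵀ + α

/-- `G_t = e^{E(-iH - (Γ^T + Γ)/2) t}`. -/
noncomputable def pairG {n : ℕ} (H Γ : Mat n) (t : ℝ) : Mat n :=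
  NormedSpace.exp ((t : ℂ) • (matE n * (-Complex.I • H - (1 / 2 : ℂ) • (Γᵀ + Γ))))

/-- `α_t = ∫_0^t e^{E(-iH - (Γ^T + Γ)/2) s} E (Γ^T - Γ)/2 E e^{(iH - (Γ^T + Γ)/2) E s} ds`, the integral
of a matrix being taken entrywise. -/
noncomputable def pairAlpha {n : ℕ} (H Γ : Mat n) (t : ℝ) : Mat n :=
  Matrix.of fun i j => ∫ s in (0 : ℝ)..t,
    (NormedSpace.exp ((s : ℂ) • (matE n * (-Complex.I • H - (1 / 2 : ℂ) • (Γᵀ + Γ))))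
      * (matE n * ((1 / 2 : ℂ) • (Γᵀ - Γ)) * matE n)
      * NormedSpace.exp ((s : ℂ) • ((Complex.I • H - (1 / 2 : ℂ) • (Γᵀ + Γ)) * matE n))) i j

end FermiGauss

namespace FermiGauss

/-! ### Canonical anticommutation relations -/

section CAR
variable {n : ℕ}

/-! Everything rests on the generator `𝓛` being quadratic in the `c`'s and on the anticommutation
relations `{𝔠_i, 𝔠_j} = E_ij`. Each property of `e^{𝓛t}` is read off from a property of `𝓛`.

Channel: since `ΓE ≥ 0`, factoring `ΓE = B†B` turns the jump term into a sum of maps `ρ ↦ VρV†`, so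
that `𝓛ρ = Kρ + ρK† + Ψρ` with `Ψ` completely positive. Up to a vanishing correction, `𝓛` is then a
completely positive map minus a multiple of the identity, and exponentials of such maps are
completely positive (`isCP_exp_of_lindblad`). Trace preservation is `tr 𝓛ρ = 0`, and parity
covariance holds because every term of `𝓛` contains an even number of `c`'s.

Moments: in the Heisenberg picture the quartic terms cancel, so the anticovariance matrix obeys the
Lyapunov equation `A' = XA + AXᵀ + N` (`anticov_quadGen`), with `X` the generator of `G_t` and `N =
E(Γᵀ - Γ)E/2`. Its solution is `G_t A G_tᵀ + α_t`.

Gaussian states: the operator `W = e^{𝛉ᵀE𝔠}` shifts `𝔠_k` to `𝔠_k + θ_k`, so `𝓛` acts on the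
characteristic function `χ` as a Grassmann derivation plus multiplication by a quadratic form
(`charFun_quadGen`). A Gaussian ansatz `e^{𝛉ᵀK𝛉/2}` solves this linear equation as soon as `K`
solves a Lyapunov equation, and uniqueness for linear equations shows that `χ` stays Gaussian. -/

theorem tensor_mul (M N : Fin n → Matrix (Fin 2) (Fin 2) ℂ) :
    tensor M * tensor N = tensor fun j => M j * N j := by
  ext x z
  simp only [tensor, Matrix.mul_apply, Matrix.of_apply, ← Finset.prod_mul_distrib]
  rw [Finset.prod_univ_sum, Fintype.piFinset_univ]

theorem tensor_one : tensor (fun _ : Fin n => (1 : Matrix (Fin 2) (Fin 2) ℂ)) = 1 := by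
  ext x y
  simp only [tensor, Matrix.of_apply, Matrix.one_apply, Finset.prod_ite_zero, Finset.mem_univ,
    forall_true_left, funext_iff, Finset.prod_const_one]

theorem tensor_apply_eq (M : Fin n → Matrix (Fin 2) (Fin 2) ℂ) (i : Fin n) (x y : Conf n) :
    tensor M x y = M i (x i) (y i) * ∏ j ∈ Finset.univ.erase i, M j (x j) (y j) := by
  simp only [tensor, Matrix.of_apply]
  exact (Finset.mul_prod_erase _ (fun j => M j (x j) (y j)) (Finset.mem_univ i)).symm

theorem tensor_neg (M N : Fin n → Matrix (Fin 2) (Fin 2) ℂ) (i : Fin n) (hi : M i = -N i)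
    (h : ∀ j, j ≠ i → M j = N j) : tensor M = -tensor N := by
  ext x y
  rw [Matrix.neg_apply, tensor_apply_eq M i, tensor_apply_eq N i, hi, Matrix.neg_apply, neg_mul]
  congr 2
  exact Finset.prod_congr rfl fun j hj => by rw [h j (Finset.ne_of_mem_erase hj)]

theorem tensor_add (M N R : Fin n → Matrix (Fin 2) (Fin 2) ℂ) (i : Fin n) (hi : M i + N i = R i)
    (hM : ∀ j, j ≠ i → M j = R j) (hN : ∀ j, j ≠ i → N j = R j) :
    tensor M + tensor N = tensor R := by
  ext x y
  rw [Matrix.add_apply, tensor_apply_eq M i, tensor_apply_eq N i, tensor_apply_eq R i, ← hi,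
    Matrix.add_apply, add_mul]
  congr 2
  · exact Finset.prod_congr rfl fun j hj => by rw [hM j (Finset.ne_of_mem_erase hj)]
  · exact Finset.prod_congr rfl fun j hj => by rw [hN j (Finset.ne_of_mem_erase hj)]

theorem tensor_conjTranspose (M : Fin n → Matrix (Fin 2) (Fin 2) ℂ) :
    (tensor M)ᴴ = tensor fun j => (M j)ᴴ := by
  ext x y
  simp [tensor, Matrix.conjTranspose_apply]

theorem sigma3_mul_self : sigma3 * sigma3 = 1 := by
  ext i j; fin_cases i <;> fin_cases j <;> simp [sigma3]

theorem sigma3_conjTranspose : sigma3ᴴ = sigma3 := by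
  ext i j; fin_cases i <;> fin_cases j <;> simp [sigma3]

theorem sigmaMinus_conjTranspose : sigmaMinusᴴ = sigmaPlus := by
  ext i j; fin_cases i <;> fin_cases j <;> simp [sigmaPlus, sigmaMinus]

theorem sigmaPlus_conjTranspose : sigmaPlusᴴ = sigmaMinus := by
  ext i j; fin_cases i <;> fin_cases j <;> simp [sigmaPlus, sigmaMinus]

theorem sigmaMinus_mul_sigma3 : sigmaMinus * sigma3 = -(sigma3 * sigmaMinus) := by
  ext i j; fin_cases i <;> fin_cases j <;> simp [sigma3, sigmaMinus]

theorem sigmaPlus_mul_sigma3 : sigmaPlus * sigma3 = -(sigma3 * sigmaPlus) := by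
  ext i j; fin_cases i <;> fin_cases j <;> simp [sigma3, sigmaPlus]

theorem sigmaMinus_add_sigmaPlus : sigmaMinus * sigmaPlus + sigmaPlus * sigmaMinus = 1 := by
  ext i j; fin_cases i <;> fin_cases j <;> simp [sigmaMinus, sigmaPlus]

theorem sigmaMinus_mul_self : sigmaMinus * sigmaMinus = 0 := by
  ext i j; fin_cases i <;> fin_cases j <;> simp [sigmaMinus]

theorem sigmaPlus_mul_self : sigmaPlus * sigmaPlus = 0 := by
  ext i j; fin_cases i <;> fin_cases j <;> simp [sigmaPlus]

/-- At the smaller of the two sites the `σ_3` of one string meets the `s` or `s'` of the other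
operator, which gives the sign; at all other sites the factors commute. -/
theorem jordanWigner_anticomm_of_ne {s s' : Matrix (Fin 2) (Fin 2) ℂ}
    (hs : s * sigma3 = -(sigma3 * s)) (hs' : s' * sigma3 = -(sigma3 * s')) {i j : Fin n}
    (hij : i ≠ j) :
    jordanWigner s i * jordanWigner s' j = -(jordanWigner s' j * jordanWigner s i) := by
  rcases lt_or_gt_of_ne hij with h | h
  · rw [jordanWigner, jordanWigner, tensor_mul, tensor_mul]
    refine tensor_neg _ _ i ?_ fun k hk => ?_
    · simp [h, hs]
    · rcases lt_trichotomy k i with h1 | h1 | h1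
      · simp [h1, h1.trans h]
      · exact absurd h1 hk
      · simp [h1.not_gt, h1.ne']
  · rw [jordanWigner, jordanWigner, tensor_mul, tensor_mul]
    refine tensor_neg _ _ j ?_ fun k hk => ?_
    · simp [h, hs']
    · rcases lt_trichotomy k j with h1 | h1 | h1
      · simp [h1, h1.trans h]
      · exact absurd h1 hk
      · simp [h1.not_gt, h1.ne']

theorem jordanWigner_mul_same (s s' : Matrix (Fin 2) (Fin 2) ℂ) (i : Fin n) :
    jordanWigner s i * jordanWigner s' i = tensor fun j => if j = i then s * s' else 1 := by
  rw [jordanWigner, jordanWigner, tensor_mul]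
  congr 1
  funext k
  rcases lt_trichotomy k i with h1 | h1 | h1
  · simp [h1, h1.ne, sigma3_mul_self]
  · simp [h1]
  · simp [h1.not_gt, h1.ne']

theorem jordanWigner_anticomm_same (s s' r : Matrix (Fin 2) (Fin 2) ℂ) (h : s * s' + s' * s = r)
    (i : Fin n) :
    jordanWigner s i * jordanWigner s' i + jordanWigner s' i * jordanWigner s i
      = tensor fun j => if j = i then r else 1 := by
  rw [jordanWigner_mul_same, jordanWigner_mul_same]
  refine tensor_add _ _ _ i ?_ ?_ ?_
  · simp [h]
  · intro j hj; simp [hj]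
  · intro j hj; simp [hj]

theorem tensor_ite_zero (i : Fin n) :
    (tensor fun j => if j = i then (0 : Matrix (Fin 2) (Fin 2) ℂ) else 1) = 0 := by
  ext x y
  rw [tensor_apply_eq _ i]
  simp

theorem matE_apply (i j : Idx n) : matE n i j = if j = i.swap then 1 else 0 := by
  rcases i with i | i <;> rcases j with j | j <;>
    simp [matE, Matrix.one_apply, eq_comm]

theorem cc_anticomm (i j : Idx n) : cc i * cc j + cc j * cc i = matE n i j • (1 : Op n) := by
  have key : ∀ (s s' : Matrix (Fin 2) (Fin 2) ℂ), s * sigma3 = -(sigma3 * s) →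
      s' * sigma3 = -(sigma3 * s') → ∀ i j : Fin n, i ≠ j →
      jordanWigner s i * jordanWigner s' j + jordanWigner s' j * jordanWigner s i = 0 := by
    intro s s' hs hs' i j hij
    rw [jordanWigner_anticomm_of_ne hs hs' hij, neg_add_cancel]
  have h3 := @sigmaMinus_mul_sigma3
  have h4 := @sigmaPlus_mul_sigma3
  rw [matE_apply]
  rcases i with i | i <;> rcases j with j | j
  · by_cases h : i = j
    · subst h
      simp [cc, jordanWigner_mul_same, sigmaMinus_mul_self, tensor_ite_zero]
    · simp [cc, key _ _ h3 h3 i j h]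
  · by_cases h : i = j
    · subst h
      simp [cc, jordanWigner_anticomm_same _ _ 1 sigmaMinus_add_sigmaPlus, tensor_one]
    · simp [cc, key _ _ h3 h4 i j h, Ne.symm h]
  · by_cases h : i = j
    · subst h
      simp [cc, jordanWigner_anticomm_same sigmaPlus sigmaMinus 1
        (by rw [add_comm, sigmaMinus_add_sigmaPlus]), tensor_one]
    · simp [cc, key _ _ h4 h3 i j h, Ne.symm h]
  · by_cases h : i = j
    · subst h
      simp [cc, jordanWigner_mul_same, sigmaPlus_mul_self, tensor_ite_zero]
    · simp [cc, key _ _ h4 h4 i j h]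

theorem cc_conjTranspose (i : Idx n) : (cc i)ᴴ = cc i.swap := by
  have key : ∀ (s : Matrix (Fin 2) (Fin 2) ℂ) (i : Fin n),
      (jordanWigner s i)ᴴ = jordanWigner sᴴ i := by
    intro s i
    rw [jordanWigner, jordanWigner, tensor_conjTranspose]
    congr 1
    funext k
    split_ifs <;> simp [sigma3_conjTranspose]
  rcases i with i | i <;> simp [cc, key, sigmaMinus_conjTranspose, sigmaPlus_conjTranspose]

theorem parity_mul_self : parity n * parity n = 1 := by
  rw [parity, tensor_mul]
  simp [sigma3_mul_self, tensor_one]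

theorem cc_mul_parity (i : Idx n) : cc i * parity n = -(parity n * cc i) := by
  have key : ∀ (s : Matrix (Fin 2) (Fin 2) ℂ), s * sigma3 = -(sigma3 * s) → ∀ i : Fin n,
      jordanWigner s i * parity n = -(parity n * jordanWigner s i) := by
    intro s hs i
    rw [jordanWigner, parity, tensor_mul, tensor_mul]
    refine tensor_neg _ _ i ?_ fun k hk => ?_
    · simp [hs]
    · rcases lt_trichotomy k i with h1 | h1 | h1
      · simp [h1]
      · exact absurd h1 hk
      · simp [h1.not_gt, h1.ne']
  rcases i with i | i
  · exact key _ sigmaMinus_mul_sigma3 i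
  · exact key _ sigmaPlus_mul_sigma3 i

theorem matE_mul_self : matE n * matE n = 1 := by
  simp [matE, Matrix.fromBlocks_multiply]

theorem matE_transpose : (matE n)ᵀ = matE n := by
  simp [matE, Matrix.fromBlocks_transpose]

end CAR

/-! ### Linear differential equations -/

section ODE

/-- Used three times, each time to identify a quantity transported by `e^{𝓛t}` with an explicit
solution: for parity, for the anticovariance matrix and for the characteristic function. -/
theorem linear_ode_unique {F : Type*} [NormedAddCommGroup F] [NormedSpace ℝ F]
    [FiniteDimensional ℝ F] (D : F →ₗ[ℝ] F) (c : F) {f g : ℝ → F}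
    (hf : ∀ t, HasDerivAt f (D (f t) + c) t) (hg : ∀ t, HasDerivAt g (D (g t) + c) t)
    (h0 : f 0 = g 0) : f = g := by
  have hv : ∀ _ : ℝ, LipschitzOnWith ‖LinearMap.toContinuousLinearMap D‖₊
      (fun x => D x + c) Set.univ := by
    intro _
    refine LipschitzWith.lipschitzOnWith ?_
    refine LipschitzWith.of_dist_le_mul fun x y => ?_
    rw [dist_add_right]
    exact (LinearMap.toContinuousLinearMap D).lipschitz.dist_le_mul x y
  exact ODE_solution_unique_univ (t₀ := 0) (s := fun _ => Set.univ) (v := fun _ x => D x + c) hv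
    (fun t => ⟨hf t, Set.mem_univ _⟩) (fun t => ⟨hg t, Set.mem_univ _⟩) h0

end ODE

/-! ### The pair `(G_t, α_t)` as solution of a Lyapunov equation -/

section Pair
open scoped Matrix.Norms.L2Operator
variable {n : ℕ}

/-- The generator `E(-iH - (Γ^T + Γ)/2)` of `G_t`. -/
noncomputable def drift (H Γ : Mat n) : Mat n :=
  matE n * (-Complex.I • H - (1 / 2 : ℂ) • (Γᵀ + Γ))

/-- The inhomogeneity `E (Γ^T - Γ)/2 E`. -/
noncomputable def noise (Γ : Mat n) : Mat n :=
  matE n * ((1 / 2 : ℂ) • (Γᵀ - Γ)) * matE n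

theorem drift_transpose {H : Mat n} (Γ : Mat n) (hH : Hᵀ = -H) :
    (drift H Γ)ᵀ = (Complex.I • H - (1 / 2 : ℂ) • (Γᵀ + Γ)) * matE n := by
  rw [drift, transpose_mul, matE_transpose, transpose_sub, transpose_smul, transpose_smul,
    transpose_add, transpose_transpose, hH, add_comm Γ, smul_neg, neg_smul, neg_neg]

theorem pairG_eq (H Γ : Mat n) (t : ℝ) : pairG H Γ t = NormedSpace.exp (t • drift H Γ) := by
  rw [pairG, drift, Complex.coe_smul]

theorem hasDerivAt_pairG (H Γ : Mat n) (t : ℝ) :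
    HasDerivAt (pairG H Γ) (drift H Γ * pairG H Γ t) t := by
  have h := hasDerivAt_exp_smul_const' (𝕂 := ℝ) (drift H Γ) t
  rw [← pairG_eq] at h
  exact h.congr_of_eventuallyEq (Filter.Eventually.of_forall fun s => pairG_eq H Γ s)

theorem pairG_zero (H Γ : Mat n) : pairG H Γ 0 = 1 := by
  rw [pairG_eq, zero_smul, NormedSpace.exp_zero]

theorem pairG_transpose {H : Mat n} (Γ : Mat n) (hH : Hᵀ = -H) (t : ℝ) :
    (pairG H Γ t)ᵀ
      = NormedSpace.exp ((t : ℂ) • ((Complex.I • H - (1 / 2 : ℂ) • (Γᵀ + Γ)) * matE n)) := by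
  rw [pairG_eq, ← Matrix.exp_transpose, transpose_smul, drift_transpose Γ hH, Complex.coe_smul]

/-- Transposition as a continuous linear map. -/
noncomputable def transposeCLM (n : ℕ) : Mat n →L[ℝ] Mat n :=
  LinearMap.toContinuousLinearMap (Matrix.transposeLinearEquiv (Idx n) (Idx n) ℝ ℂ).toLinearMap

theorem hasDerivAt_conj_pairG (H Γ A : Mat n) (t : ℝ) :
    HasDerivAt (fun s => pairG H Γ s * A * (pairG H Γ s)ᵀ)
      (drift H Γ * (pairG H Γ t * A * (pairG H Γ t)ᵀ)
        + (pairG H Γ t * A * (pairG H Γ t)ᵀ) * (drift H Γ)ᵀ) t := by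
  have h1 := hasDerivAt_pairG H Γ t
  have h2 : HasDerivAt (fun s => (pairG H Γ s)ᵀ) ((drift H Γ * pairG H Γ t)ᵀ) t :=
    (transposeCLM n).hasFDerivAt.comp_hasDerivAt t h1
  refine ((h1.mul_const A).mul h2).congr_deriv ?_
  rw [transpose_mul]
  simp only [Matrix.mul_assoc]

theorem pairAlpha_eq {H : Mat n} (Γ : Mat n) (hH : Hᵀ = -H) (t : ℝ) :
    pairAlpha H Γ t
      = ∫ s in (0 : ℝ)..t, pairG H Γ s * noise Γ * (pairG H Γ s)ᵀ := by
  have hcont : Continuous fun s => pairG H Γ s * noise Γ * (pairG H Γ s)ᵀ :=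
    continuous_iff_continuousAt.2 fun s => (hasDerivAt_conj_pairG H Γ _ s).continuousAt
  ext i j
  have := (LinearMap.toContinuousLinearMap (Matrix.entryLinearMap ℝ ℂ i j :
    Mat n →ₗ[ℝ] ℂ)).intervalIntegral_comp_comm
      (hcont.intervalIntegrable (μ := MeasureTheory.volume) 0 t)
  refine Eq.trans ?_ this
  rw [pairAlpha, Matrix.of_apply]
  refine intervalIntegral.integral_congr fun s _ => ?_
  simp only [LinearMap.coe_toContinuousLinearMap', Matrix.entryLinearMap_apply]
  rw [pairG_transpose Γ hH s, pairG, noise]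

theorem hasDerivAt_pairAlpha {H : Mat n} (Γ : Mat n) (hH : Hᵀ = -H) (t : ℝ) :
    HasDerivAt (pairAlpha H Γ) (pairG H Γ t * noise Γ * (pairG H Γ t)ᵀ) t := by
  have hcont : Continuous fun s => pairG H Γ s * noise Γ * (pairG H Γ s)ᵀ :=
    continuous_iff_continuousAt.2 fun s => (hasDerivAt_conj_pairG H Γ _ s).continuousAt
  have := intervalIntegral.integral_hasDerivAt_right
    (hcont.intervalIntegrable (μ := MeasureTheory.volume) 0 t)
    (hcont.stronglyMeasurableAtFilter _ _) hcont.continuousAt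
  exact this.congr_of_eventuallyEq (Filter.Eventually.of_forall fun s => pairAlpha_eq Γ hH s)

theorem pairAlpha_zero {H : Mat n} (Γ : Mat n) (hH : Hᵀ = -H) : pairAlpha H Γ 0 = 0 := by
  rw [pairAlpha_eq Γ hH, intervalIntegral.integral_same]

/-- The integral `α_t` differentiates to `G N Gᵀ`, whereas the Lyapunov equation asks for `Xα + αXᵀ
+ N`. The difference `G N Gᵀ - (Xα + αXᵀ)` has derivative zero and equals `N` at time `0`. -/
theorem conj_noise_eq {H : Mat n} (Γ : Mat n) (hH : Hᵀ = -H) (t : ℝ) :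
    pairG H Γ t * noise Γ * (pairG H Γ t)ᵀ
      = drift H Γ * pairAlpha H Γ t + pairAlpha H Γ t * (drift H Γ)ᵀ + noise Γ := by
  have hd : ∀ s, HasDerivAt (fun t => pairG H Γ t * noise Γ * (pairG H Γ t)ᵀ
      - (drift H Γ * pairAlpha H Γ t + pairAlpha H Γ t * (drift H Γ)ᵀ)) 0 s := fun s => by
    have h1 := hasDerivAt_conj_pairG H Γ (noise Γ) s
    have h2 := hasDerivAt_pairAlpha Γ hH s
    exact (h1.sub ((h2.const_mul (drift H Γ)).add (h2.mul_const (drift H Γ)ᵀ))).congr_deriv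
      (sub_self _)
  have hc := is_const_of_deriv_eq_zero (fun s => (hd s).differentiableAt)
    (fun s => (hd s).deriv) t 0
  simp only [pairG_zero, pairAlpha_zero Γ hH, transpose_one, mul_one, one_mul, mul_zero, zero_mul,
    add_zero, sub_zero] at hc
  rw [sub_eq_iff_eq_add] at hc
  rw [hc, add_comm]

/-- The solution of the Lyapunov equation with initial value `A`. -/
noncomputable def evolve (H Γ A : Mat n) (t : ℝ) : Mat n :=
  pairG H Γ t * A * (pairG H Γ t)ᵀ + pairAlpha H Γ t

theorem evolve_zero {H : Mat n} (Γ A : Mat n) (hH : Hᵀ = -H) : evolve H Γ A 0 = A := by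
  simp [evolve, pairG_zero, pairAlpha_zero Γ hH]

theorem hasDerivAt_evolve {H : Mat n} (Γ A : Mat n) (hH : Hᵀ = -H) (t : ℝ) :
    HasDerivAt (evolve H Γ A)
      (drift H Γ * evolve H Γ A t + evolve H Γ A t * (drift H Γ)ᵀ + noise Γ) t := by
  refine ((hasDerivAt_conj_pairG H Γ A t).add (hasDerivAt_pairAlpha Γ hH t)).congr_deriv ?_
  rw [conj_noise_eq Γ hH, evolve, mul_add, add_mul]
  abel

end Pair

/-! ### The semigroup as solution of `ρ' = 𝓛ρ` -/

section SuperExp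
open scoped Matrix.Norms.L2Operator
variable {n : ℕ}

theorem superExp_apply (L : Op n →ₗ[ℂ] Op n) (t : ℝ) (ρ : Op n) :
    superExp L t ρ = NormedSpace.exp (t • LinearMap.toContinuousLinearMap L) ρ := by
  have h : (t : ℂ) • LinearMap.toContinuousLinearMap L = t • LinearMap.toContinuousLinearMap L :=
    Complex.coe_smul t (LinearMap.toContinuousLinearMap L)
  exact congrArg (fun A : Op n →L[ℂ] Op n => NormedSpace.exp A ρ) h

theorem hasDerivAt_superExp (L : Op n →ₗ[ℂ] Op n) (ρ : Op n) (t : ℝ) :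
    HasDerivAt (fun s => superExp L s ρ) (L (superExp L t ρ)) t := by
  have h := hasDerivAt_exp_smul_const' (𝕂 := ℝ) (LinearMap.toContinuousLinearMap L) t
  have h2 := ((ContinuousLinearMap.apply ℂ (Op n) ρ).restrictScalars ℝ).hasFDerivAt.comp_hasDerivAt
    t h
  simp only [superExp_apply]
  exact h2

theorem superExp_zero (L : Op n →ₗ[ℂ] Op n) (ρ : Op n) : superExp L 0 ρ = ρ := by
  have h : (0 : ℝ) • LinearMap.toContinuousLinearMap L = 0 :=
    ContinuousLinearMap.ext fun ρ => zero_smul ℝ (L ρ)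
  rw [superExp_apply, h, NormedSpace.exp_zero]
  rfl

end SuperExp

/-! ### Complete positivity of the semigroup -/

section CompletePositivity
open scoped Matrix.Norms.L2Operator MatrixOrder
variable {n : ℕ}

/-- Complete positivity of a superoperator. -/
def IsCP (Φ : Op n →L[ℂ] Op n) : Prop :=
  ∀ (k : ℕ) (M : CStarMatrix (Fin k) (Fin k) (Op n)), 0 ≤ M → 0 ≤ M.map Φ

theorem isCP_zero : IsCP (0 : Op n →L[ℂ] Op n) := fun k M _ => by
  have : M.map (0 : Op n →L[ℂ] Op n) = 0 := by ext i j; simp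
  rw [this]

theorem IsCP.add {Φ Ψ : Op n →L[ℂ] Op n} (hΦ : IsCP Φ) (hΨ : IsCP Ψ) : IsCP (Φ + Ψ) :=
  fun k M hM => by
    have : M.map (Φ + Ψ) = M.map Φ + M.map Ψ := by ext i j; simp
    rw [this]
    exact add_nonneg (hΦ k M hM) (hΨ k M hM)

theorem IsCP.mul {Φ Ψ : Op n →L[ℂ] Op n} (hΦ : IsCP Φ) (hΨ : IsCP Ψ) : IsCP (Φ * Ψ) :=
  fun k M hM => hΦ k _ (hΨ k M hM)

theorem isCP_one : IsCP (1 : Op n →L[ℂ] Op n) := fun _ _ hM => hM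

theorem IsCP.sum {ι : Type*} (s : Finset ι) {Φ : ι → Op n →L[ℂ] Op n} (h : ∀ i, IsCP (Φ i)) :
    IsCP (∑ i ∈ s, Φ i) :=
  Finset.sum_induction _ IsCP (fun _ _ => IsCP.add) isCP_zero fun i _ => h i

theorem IsCP.pow {Φ : Op n →L[ℂ] Op n} (hΦ : IsCP Φ) (m : ℕ) : IsCP (Φ ^ m) := by
  induction m with
  | zero => simpa using isCP_one
  | succ m ih => simpa [pow_succ] using ih.mul hΦ

/-- The superoperator `ρ ↦ V ρ V†`. -/
noncomputable def krausMap (V : Op n) : Op n →L[ℂ] Op n :=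
  LinearMap.toContinuousLinearMap (LinearMap.mulLeft ℂ V ∘ₗ LinearMap.mulRight ℂ Vᴴ)

theorem krausMap_apply (V ρ : Op n) : krausMap V ρ = V * (ρ * Vᴴ) := rfl

theorem isCP_krausMap (V : Op n) : IsCP (krausMap V) := fun k M hM => by
  let D : CStarMatrix (Fin k) (Fin k) (Op n) := CStarMatrix.ofMatrix (Matrix.diagonal fun _ => V)
  have h1 : D * M = CStarMatrix.ofMatrix (Matrix.of fun i j => V * M i j) :=
    CStarMatrix.ext fun i j =>
      Matrix.diagonal_mul (fun _ : Fin k => V) (CStarMatrix.ofMatrix.symm M) i j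
  have h2 : star D = CStarMatrix.ofMatrix (Matrix.diagonal fun _ => Vᴴ) :=
    Matrix.diagonal_conjTranspose (fun _ : Fin k => V)
  have this : M.map (krausMap V) = D * M * star D := by
    rw [h1, h2]
    refine CStarMatrix.ext fun i j => Eq.trans ?_
      (Matrix.mul_diagonal (fun _ : Fin k => Vᴴ) (Matrix.of fun i j => V * M i j) i j).symm
    simp [krausMap_apply, Matrix.mul_assoc]
  rw [this]
  exact star_right_conjugate_nonneg hM D

theorem IsCP.smul {Φ : Op n →L[ℂ] Op n} (hΦ : IsCP Φ) {r : ℝ} (hr : 0 ≤ r) : IsCP (r • Φ) := by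
  -- Scaling by `r ≥ 0` is conjugation by `√r · 1`, hence completely positive.
  have : r • Φ = krausMap (((√r : ℝ) : ℂ) • (1 : Op n)) * Φ := by
    ext ρ : 1
    have h : ((√r : ℝ) : ℂ) * ((√r : ℝ) : ℂ) = (r : ℂ) := by
      rw [← Complex.ofReal_mul, Real.mul_self_sqrt hr]
    simp only [_root_.smul_apply, mul_apply_eq_comp, krausMap_apply,
      conjTranspose_smul, conjTranspose_one, Matrix.mul_smul, Matrix.smul_mul, Matrix.mul_one,
      Matrix.one_mul, smul_smul]
    rw [← Complex.coe_smul]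
    simp [h]
  rw [this]
  exact (isCP_krausMap _).mul hΦ

theorem isClosed_isCP : IsClosed {Φ : Op n →L[ℂ] Op n | IsCP Φ} := by
  simp only [IsCP, Set.ofPred_forall]
  refine isClosed_iInter fun k => isClosed_iInter fun M => isClosed_iInter fun _ => ?_
  have hc : Continuous fun Φ : Op n →L[ℂ] Op n => M.map Φ := by
    refine continuous_pi fun i => continuous_pi fun j => ?_
    exact (ContinuousLinearMap.apply ℂ (Op n) (M i j)).continuous
  exact CStarAlgebra.isClosed_nonneg.preimage hc

/-- The exponential series has nonnegative coefficients, and the completely positive maps form a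
closed cone stable under composition. -/
theorem IsCP.exp {Φ : Op n →L[ℂ] Op n} (hΦ : IsCP Φ) : IsCP (NormedSpace.exp Φ) := by
  have h := NormedSpace.exp_series_hasSum_exp' (𝕂 := ℝ) Φ
  exact isClosed_isCP.mem_of_tendsto h (Filter.Eventually.of_forall fun s =>
    IsCP.sum s fun m => (hΦ.pow m).smul (by positivity))

theorem exp_add_smul_one {A : Type*} [NormedRing A] [NormedAlgebra ℝ A] [CompleteSpace A] (a : A)
    (r : ℝ) : NormedSpace.exp (a + r • (1 : A)) = Real.exp r • NormedSpace.exp a := by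
  let _ : NormedAlgebra ℚ A := NormedAlgebra.restrictScalars ℚ ℝ A
  rw [NormedSpace.exp_add_of_commute ((Commute.one_right a).smul_right r),
    ← Algebra.algebraMap_eq_smul_one, ← NormedSpace.algebraMap_exp_comm, ← Real.exp_eq_exp_ℝ,
    ← Algebra.commutes, ← Algebra.smul_def]

/-- The semigroup of a generator of Lindblad form is completely positive. -/
theorem isCP_exp_of_lindblad {L Ψ : Op n →L[ℂ] Op n} (hΨ : IsCP Ψ) (K : Op n)
    (hL : ∀ ρ, L ρ = K * ρ + ρ * Kᴴ + Ψ ρ) {t : ℝ} (ht : 0 ≤ t) :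
    IsCP (NormedSpace.exp (t • L)) := by
  -- With `V = s·1 + s⁻¹K` one has `VρV† = s²ρ + Kρ + ρK† + s⁻²KρK†`. Adding `s⁻²KρK†` to `L`
  -- therefore gives a completely positive map minus `s²` times the identity, whose exponential is a
  -- positive scalar times that of a completely positive map. The correction disappears as `s → ∞`;
  -- the shift by one keeps `s` away from zero.
  let s : ℕ → ℝ := fun m => (m : ℝ) + 1
  have hs : ∀ m, s m ≠ 0 := fun m => by positivity
  let V : ℕ → Op n := fun m => (s m : ℂ) • (1 : Op n) + ((s m)⁻¹ : ℂ) • K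
  have hV : ∀ m, L + (s m ^ 2)⁻¹ • krausMap K
      = (krausMap (V m) + Ψ) + (-(s m ^ 2)) • (1 : Op n →L[ℂ] Op n) := by
    intro m
    have hs' : (s m : ℂ) ≠ 0 := by exact_mod_cast hs m
    ext ρ : 1
    simp only [_root_.add_apply, _root_.smul_apply, krausMap_apply, hL,
      V, conjTranspose_add, conjTranspose_smul, conjTranspose_one, Matrix.mul_add, Matrix.add_mul,
      Matrix.mul_smul, Matrix.smul_mul, Matrix.mul_one, Matrix.one_mul, smul_add, smul_smul,
      one_apply_eq_self, star_inv₀, ← Complex.coe_smul, Complex.star_def,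
      Complex.conj_ofReal]
    have e1 : (s m : ℂ) * (s m : ℂ)⁻¹ = 1 := mul_inv_cancel₀ hs'
    have e2 : (s m : ℂ)⁻¹ * (s m : ℂ) = 1 := inv_mul_cancel₀ hs'
    rw [e1, e2]
    push_cast
    rw [neg_smul, ← sq, ← mul_inv, ← sq, one_smul, one_smul]
    abel
  have hcp : ∀ m, IsCP (NormedSpace.exp (t • (L + (s m ^ 2)⁻¹ • krausMap K))) := by
    intro m
    have e : NormedSpace.exp (t • (L + (s m ^ 2)⁻¹ • krausMap K))
        = Real.exp (t * -(s m ^ 2)) • NormedSpace.exp (t • (krausMap (V m) + Ψ)) := by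
      rw [hV]
      refine Eq.trans ?_ (exp_add_smul_one (t • (krausMap (V m) + Ψ)) (t * -(s m ^ 2)))
      congr 1
      ext ρ : 1
      simp only [_root_.smul_apply, _root_.add_apply, smul_add, smul_smul]
    rw [e]
    exact (((isCP_krausMap _).add hΨ).smul ht).exp.smul (Real.exp_pos _).le
  have hlim : Filter.Tendsto (fun m => NormedSpace.exp (t • (L + (s m ^ 2)⁻¹ • krausMap K)))
      Filter.atTop (nhds (NormedSpace.exp (t • L))) := by
    have h1 : Filter.Tendsto s Filter.atTop Filter.atTop :=
      Filter.tendsto_atTop_add_const_right _ _ tendsto_natCast_atTop_atTop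
    have h2 : Filter.Tendsto (fun m => (s m ^ 2)⁻¹) Filter.atTop (nhds 0) :=
      ((Filter.tendsto_pow_atTop two_ne_zero).comp h1).inv_tendsto_atTop
    have h3 : Filter.Tendsto (fun m => t • (L + (s m ^ 2)⁻¹ • krausMap K))
        Filter.atTop (nhds (t • (L + (0 : ℝ) • krausMap K))) :=
      ((h2.smul_const _).const_add _).const_smul _
    have h4 : t • (L + (0 : ℝ) • krausMap K) = t • L := by
      ext ρ : 1
      simp only [_root_.smul_apply, _root_.add_apply, zero_smul, add_zero]
    rw [h4] at h3
    let _ : NormedAlgebra ℚ (Op n →L[ℂ] Op n) := NormedAlgebra.restrictScalars ℚ ℂ _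
    have hc : Continuous (NormedSpace.exp : (Op n →L[ℂ] Op n) → Op n →L[ℂ] Op n) :=
      NormedSpace.exp_continuous (𝔸 := Op n →L[ℂ] Op n)
    exact (hc.tendsto _).comp h3
  exact isClosed_isCP.mem_of_tendsto hlim (Filter.Eventually.of_forall hcp)

end CompletePositivity

/-! ### The generator in Lindblad form -/

section Generator
variable {n : ℕ}

theorem linForm_zero : linForm (0 : Idx n → ℂ) = 0 := by simp [linForm]

theorem sum_swap_swap (f : Idx n → Idx n → Op n) :
    ∑ i : Idx n, ∑ j : Idx n, f i.swap j.swap = ∑ i, ∑ j, f i j := by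
  refine (Equiv.sum_comp (Equiv.sumComm (Fin n) (Fin n)) fun i => ∑ j : Idx n, f i j.swap).trans ?_
  exact Finset.sum_congr rfl fun i _ => Equiv.sum_comp (Equiv.sumComm (Fin n) (Fin n)) _

theorem matE_mul_apply (M : Mat n) (i j : Idx n) : (matE n * M) i j = M i.swap j := by
  simp [Matrix.mul_apply, matE_apply]

theorem mul_matE_apply (M : Mat n) (i j : Idx n) : (M * matE n) i j = M i j.swap := by
  have : ∀ k : Idx n, (j = k.swap) = (k = j.swap) := fun k => by
    apply propext
    constructor <;> rintro rfl <;> simp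
  simp [Matrix.mul_apply, matE_apply, this]

theorem tildeConj_apply (M : Mat n) (i j : Idx n) : tildeConj M i j = star (M i.swap j.swap) := by
  rw [tildeConj, mul_matE_apply, matE_mul_apply, Matrix.map_apply]

theorem quadForm_conjTranspose (M : Mat n) : (quadForm M)ᴴ = quadForm (tildeConj M)ᵀ := by
  simp only [quadForm, conjTranspose_sum, conjTranspose_smul, conjTranspose_mul, cc_conjTranspose,
    transpose_apply, tildeConj_apply]
  rw [Finset.sum_comm, ← sum_swap_swap]
  simp

/-- The effective non-self-adjoint Hamiltonian, times `-i`. -/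
noncomputable def effective (H Γ : Mat n) : Op n :=
  (-Complex.I * (1 / 2)) • quadForm H - (1 / 2 : ℂ) • quadForm Γᵀ

/-- The symmetry conditions on `H` and on `Γ` say that `𝔠ᵀH𝔠` and `𝔠ᵀΓᵀ𝔠` are self-adjoint, so
taking the adjoint only conjugates the scalar coefficients. -/
theorem effective_conjTranspose {H Γ : Mat n} (hH : Hᵀ = -H) (hH' : tildeConj H = -H)
    (hΓ : Γᵀ = tildeConj Γ) :
    (effective H Γ)ᴴ = (Complex.I * (1 / 2)) • quadForm H - (1 / 2 : ℂ) • quadForm Γᵀ := by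
  have h1 : (tildeConj H)ᵀ = H := by rw [hH', transpose_neg, hH, neg_neg]
  have h2 : (tildeConj Γᵀ)ᵀ = Γᵀ := by
    congr 1
    ext i j
    rw [hΓ]
    simp [tildeConj_apply]
  rw [effective, conjTranspose_sub, conjTranspose_smul, conjTranspose_smul, quadForm_conjTranspose,
    quadForm_conjTranspose, h1, h2]
  simp

theorem quadGen_apply {H Γ : Mat n} (hH : Hᵀ = -H) (hH' : tildeConj H = -H)
    (hΓ : Γᵀ = tildeConj Γ) (ρ : Op n) :
    quadGen H Γ 0 ρ = effective H Γ * ρ + ρ * (effective H Γ)ᴴ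
      + ∑ i, ∑ j, Γ i j • (cc i * ρ * cc j) := by
  rw [effective_conjTranspose hH hH' hΓ]
  simp only [quadGen, LinearMap.coe_mk, AddHom.coe_mk, linForm_zero, add_zero, effective,
    Matrix.sub_mul, Matrix.mul_sub, Matrix.smul_mul, Matrix.mul_smul, smul_sub, smul_smul,
    neg_mul, neg_smul]
  abel

/-- Multiplication by `E` exchanges `c_j` and `c_j†`, so `ΓE` is the coefficient matrix of `𝔠_i ρ
𝔠_j†`. Its factorization supplies the Kraus operators, one for each row of `B`. -/
theorem jump_eq_sum {Γ B : Mat n} (hB : Γ * matE n = Bᴴ * B) (ρ : Op n) :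
    ∑ i, ∑ j, Γ i j • (cc i * ρ * cc j)
      = ∑ k, krausMap (∑ i, star (B k i) • cc i) ρ := by
  have hΓ : ∀ i j : Idx n, Γ i j.swap = ∑ k, star (B k i) * B k j := fun i j => by
    rw [← mul_matE_apply Γ, hB, Matrix.mul_apply]
    simp
  have h1 : ∀ i, ∑ j, Γ i j • (cc i * ρ * cc j)
      = ∑ j : Idx n, Γ i j.swap • (cc i * ρ * cc j.swap) := fun i =>
    (Equiv.sum_comp (Equiv.sumComm (Fin n) (Fin n)) fun j => Γ i j • (cc i * ρ * cc j)).symm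
  rw [Finset.sum_congr rfl fun i _ => h1 i]
  simp only [hΓ, krausMap_apply, conjTranspose_sum, conjTranspose_smul, star_star,
    cc_conjTranspose, Finset.sum_mul, Finset.mul_sum, Finset.sum_smul, Matrix.smul_mul,
    Matrix.mul_smul, smul_smul, Matrix.mul_assoc]
  rw [Finset.sum_congr rfl fun i _ => Finset.sum_comm, Finset.sum_comm]
  refine Finset.sum_congr rfl fun k _ => ?_
  rw [Finset.sum_comm]
  exact Finset.sum_congr rfl fun j _ => Finset.sum_congr rfl fun i _ => by rw [mul_comm]

end Generator

/-! ### Trace preservation, complete positivity and parity covariance -/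

section Channel
open scoped Matrix.Norms.L2Operator MatrixOrder
variable {n : ℕ}

theorem trace_quadGen (H Γ : Mat n) (ρ : Op n) : (quadGen H Γ 0 ρ).trace = 0 := by
  have h1 : ∀ i j : Idx n, (cc i * ρ * cc j).trace = (cc j * cc i * ρ).trace := fun i j => by
    rw [trace_mul_comm, Matrix.mul_assoc]
  have h2 : (∑ i, ∑ j, Γ i j • (cc i * ρ * cc j)).trace = (quadForm Γᵀ * ρ).trace := by
    simp only [quadForm, trace_sum, trace_smul, h1, Finset.sum_mul, Matrix.smul_mul,
      transpose_apply]
    exact Finset.sum_comm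
  simp only [quadGen, LinearMap.coe_mk, AddHom.coe_mk, trace_sub, trace_add, trace_smul, h2,
    trace_mul_comm ρ, smul_eq_mul]
  ring

theorem trace_superExp (H Γ : Mat n) (t : ℝ) (ρ : Op n) :
    (superExp (quadGen H Γ 0) t ρ).trace = ρ.trace := by
  let T : Op n →L[ℝ] ℂ := LinearMap.toContinuousLinearMap (Matrix.traceLinearMap (Conf n) ℝ ℂ)
  have hd : ∀ s, HasDerivAt (fun s => T (superExp (quadGen H Γ 0) s ρ)) 0 s := fun s =>
    (T.hasFDerivAt.comp_hasDerivAt s (hasDerivAt_superExp (quadGen H Γ 0) ρ s)).congr_deriv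
      (trace_quadGen H Γ _)
  have := is_const_of_deriv_eq_zero (fun s => (hd s).differentiableAt) (fun s => (hd s).deriv) t 0
  rw [superExp_zero] at this
  exact this

theorem isChannel_superExp {H Γ : Mat n} (hH : Hᵀ = -H) (hH' : tildeConj H = -H)
    (hΓ : Γᵀ = tildeConj Γ) (hΓE : (Γ * matE n).PosSemidef) {t : ℝ} (ht : 0 ≤ t) :
    IsChannel (superExp (quadGen H Γ 0) t) := by
  refine ⟨?_, trace_superExp H Γ t⟩
  obtain ⟨B, hB⟩ := CStarAlgebra.nonneg_iff_eq_star_mul_self.mp hΓE.nonneg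
  have hcp : IsCP (NormedSpace.exp (t • LinearMap.toContinuousLinearMap (quadGen H Γ 0))) := by
    refine isCP_exp_of_lindblad (Ψ := ∑ k, krausMap (∑ i, star (B k i) • cc i))
      (IsCP.sum _ fun k => isCP_krausMap _) (effective H Γ) (fun ρ => ?_) ht
    rw [_root_.sum_apply, ← jump_eq_sum hB]
    exact quadGen_apply hH hH' hΓ ρ
  have hfun : ⇑(superExp (quadGen H Γ 0) t)
      = ⇑(NormedSpace.exp (t • LinearMap.toContinuousLinearMap (quadGen H Γ 0))) :=
    funext fun ρ => superExp_apply _ t ρ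
  refine ⟨⟨superExp (quadGen H Γ 0) t, fun k M hM => ?_⟩, rfl⟩
  have := hcp k M hM
  rw [← hfun] at this
  exact this

theorem IsChannel.isDensity {Φ : Op n →ₗ[ℂ] Op n} (hΦ : IsChannel Φ) {ρ : Op n}
    (hρ : IsDensity ρ) : IsDensity (Φ ρ) := by
  obtain ⟨⟨Ψ, rfl⟩, htr⟩ := hΦ
  refine ⟨?_, (htr ρ).trans hρ.2⟩
  have h0 : (0 : Op n) ≤ ρ := hρ.1.nonneg
  have := OrderHomClass.mono Ψ h0
  rw [map_zero] at this
  exact nonneg_iff_posSemidef.1 this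

theorem parity_quadGen (H Γ : Mat n) (ρ : Op n) :
    quadGen H Γ 0 (parity n * ρ * parity n) = parity n * quadGen H Γ 0 ρ * parity n := by
  have hP := parity_mul_self (n := n)
  have hc := cc_mul_parity (n := n)
  have h1 : ∀ i X, cc i * (parity n * X) = -(parity n * (cc i * X)) := fun i X => by
    rw [← Matrix.mul_assoc, hc, Matrix.neg_mul, Matrix.mul_assoc]
  have h2 : ∀ i, parity n * cc i = -(cc i * parity n) := fun i => by rw [hc, neg_neg]
  have hq : ∀ M : Mat n, quadForm M * parity n = parity n * quadForm M := fun M => by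
    simp only [quadForm, Finset.sum_mul, Finset.mul_sum, Matrix.smul_mul, Matrix.mul_smul]
    refine Finset.sum_congr rfl fun i _ => Finset.sum_congr rfl fun j _ => ?_
    rw [Matrix.mul_assoc, hc, Matrix.mul_neg, h1, neg_neg]
  have hq1 : ∀ (M : Mat n) X, quadForm M * (parity n * X * parity n)
      = parity n * (quadForm M * X) * parity n := fun M X => by
    simp only [← Matrix.mul_assoc, hq]
  have hq2 : ∀ (M : Mat n) X, (parity n * X * parity n) * quadForm M
      = parity n * (X * quadForm M) * parity n := fun M X => by
    rw [Matrix.mul_assoc, ← hq]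
    simp only [Matrix.mul_assoc]
  have hj : ∀ i j, cc i * (parity n * ρ * parity n) * cc j
      = parity n * (cc i * ρ * cc j) * parity n := fun i j => by
    rw [Matrix.mul_assoc, Matrix.mul_assoc, h2, Matrix.mul_neg, Matrix.mul_neg, Matrix.mul_assoc,
      h1, neg_neg]
    simp only [Matrix.mul_assoc]
  simp only [quadGen, LinearMap.coe_mk, AddHom.coe_mk, linForm_zero, add_zero, Matrix.smul_mul,
    Matrix.mul_smul, hq1, hq2, hj, Matrix.mul_add, Matrix.mul_sub, Matrix.add_mul, Matrix.sub_mul,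
    Finset.sum_mul, Finset.mul_sum]

theorem parity_superExp (H Γ : Mat n) (t : ℝ) (ρ : Op n) :
    superExp (quadGen H Γ 0) t (parity n * ρ * parity n)
      = parity n * superExp (quadGen H Γ 0) t ρ * parity n := by
  let D : Op n →ₗ[ℝ] Op n := (quadGen H Γ 0).restrictScalars ℝ
  have h := linear_ode_unique D 0
    (f := fun s => superExp (quadGen H Γ 0) s (parity n * ρ * parity n))
    (g := fun s => parity n * superExp (quadGen H Γ 0) s ρ * parity n)
    (fun s => (hasDerivAt_superExp _ _ s).congr_deriv (add_zero _).symm)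
    (fun s => (((hasDerivAt_superExp (quadGen H Γ 0) ρ s).const_mul (parity n)).mul_const
      (parity n)).congr_deriv (by rw [add_zero]; exact (parity_quadGen H Γ _).symm))
    (by simp only [superExp_zero])
  exact congrFun h t

end Channel

/-! ### Evolution of the second moments -/

section Moments
variable {n : ℕ}

theorem matE_symm (i j : Idx n) : matE n i j = matE n j i := by
  conv_lhs => rw [← matE_transpose, transpose_apply]

theorem cc_mul_cc (i j : Idx n) : cc i * cc j = matE n i j • (1 : Op n) - cc j * cc i :=
  eq_sub_of_add_eq (cc_anticomm i j)

theorem cc_mul_cc_mul (i j : Idx n) (Y : Op n) :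
    cc i * (cc j * Y) = matE n i j • Y - cc j * (cc i * Y) := by
  rw [← Matrix.mul_assoc, cc_mul_cc, Matrix.sub_mul, Matrix.smul_mul, Matrix.one_mul,
    Matrix.mul_assoc]

theorem cc_commutator (a i j : Idx n) :
    cc a * (cc i * cc j) - cc i * cc j * cc a = matE n a i • cc j - matE n a j • cc i := by
  rw [cc_mul_cc_mul, cc_mul_cc a j, Matrix.mul_sub, Matrix.mul_smul, Matrix.mul_one,
    Matrix.mul_assoc]
  module

theorem pair_commutator (a b i j : Idx n) :
    cc a * cc b * (cc i * cc j) - cc i * cc j * (cc a * cc b)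
      = matE n b i • (cc a * cc j) - matE n b j • (cc a * cc i)
        + matE n a i • (cc j * cc b) - matE n a j • (cc i * cc b) := by
  have h1 := congrArg (cc a * ·) (cc_commutator b i j)
  have h2 := congrArg (· * cc b) (cc_commutator a i j)
  simp only [Matrix.mul_sub, Matrix.sub_mul, Matrix.mul_smul, Matrix.smul_mul,
    Matrix.mul_assoc] at h1 h2 ⊢
  rw [add_sub_assoc, ← h1, ← h2]
  abel

/-- For `Y = 𝔠_i 𝔠_j` the left side is half of `[𝔠_b, Y]𝔠_a - 𝔠_b[𝔠_a, Y]`. Both commutators are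
linear in `𝔠`, so no quartic term survives and the second moments evolve among themselves. -/
theorem pair_dissipator (a b i j : Idx n) :
    cc b * (cc i * cc j) * cc a - (1 / 2 : ℂ) • (cc b * cc a * (cc i * cc j))
        - (1 / 2 : ℂ) • (cc i * cc j * (cc b * cc a))
      = (1 / 2 : ℂ) • (matE n j a • (cc b * cc i) - matE n i a • (cc b * cc j)
        + matE n b i • (cc j * cc a) - matE n b j • (cc i * cc a)) := by
  have h1 := congrArg (cc b * ·) (cc_commutator a i j)
  have h2 := congrArg (· * cc a) (cc_commutator b i j)
  simp only [Matrix.mul_sub, Matrix.sub_mul, Matrix.mul_smul, Matrix.smul_mul,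
    Matrix.mul_assoc] at h1 h2 ⊢
  rw [matE_symm j a, matE_symm i a]
  have h3 : matE n a j • (cc b * cc i) - matE n a i • (cc b * cc j)
      = -(cc b * (cc a * (cc i * cc j)) - cc b * (cc i * (cc j * cc a))) := by rw [h1]; abel
  rw [add_sub_assoc, ← h2, h3]
  module

theorem trace_mul_quadForm_comm (M : Mat n) (Y ρ : Op n) :
    (Y * (quadForm M * ρ - ρ * quadForm M)).trace
      = ∑ a, ∑ b, M a b * ((Y * (cc a * cc b) - cc a * cc b * Y) * ρ).trace := by
  have h : (Y * (quadForm M * ρ - ρ * quadForm M)).trace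
      = ((Y * quadForm M - quadForm M * Y) * ρ).trace := by
    rw [Matrix.mul_sub, Matrix.sub_mul, trace_sub, trace_sub, ← Matrix.mul_assoc,
      ← Matrix.mul_assoc,
      trace_mul_comm _ (quadForm M), Matrix.mul_assoc (quadForm M)]
  rw [h]
  simp only [quadForm, Finset.mul_sum, Finset.sum_mul, Matrix.mul_smul, Matrix.smul_mul,
    ← Finset.sum_sub_distrib, ← smul_sub, trace_sum, trace_smul, smul_eq_mul]

/-- Passage to the Heisenberg picture by cyclicity of the trace: the dissipator is moved from `ρ`
onto the observable `Y`. -/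
theorem trace_mul_dissipator (M : Mat n) (Y ρ : Op n) :
    (Y * (∑ i, ∑ j, M i j • (cc i * ρ * cc j) - (1 / 2 : ℂ) • (quadForm Mᵀ * ρ)
        - (1 / 2 : ℂ) • (ρ * quadForm Mᵀ))).trace
      = ∑ a, ∑ b, M a b * ((cc b * Y * cc a - (1 / 2 : ℂ) • (cc b * cc a * Y)
          - (1 / 2 : ℂ) • (Y * (cc b * cc a))) * ρ).trace := by
  have h1 : quadForm Mᵀ = ∑ a, ∑ b, M a b • (cc b * cc a) := by
    rw [quadForm, Finset.sum_comm]; rfl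
  have h2 : ∀ a b, (Y * (cc a * ρ * cc b)).trace = (cc b * Y * cc a * ρ).trace := fun a b => by
    rw [← Matrix.mul_assoc, trace_mul_comm]
    simp only [Matrix.mul_assoc]
  have h3 : ∀ a b, (Y * (ρ * (cc b * cc a))).trace = (cc b * cc a * Y * ρ).trace := fun a b => by
    rw [← Matrix.mul_assoc, trace_mul_comm]
    simp only [Matrix.mul_assoc]
  rw [h1]
  simp only [Matrix.sub_mul, Matrix.mul_smul, Matrix.smul_mul, Finset.mul_sum,
    Finset.sum_mul, trace_sub, trace_smul, trace_sum, h2, h3, smul_eq_mul, mul_sub,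
    Finset.sum_sub_distrib]
  simp only [mul_left_comm (1 / 2 : ℂ), Matrix.mul_assoc]
  ring

theorem secondMoments_quadGen (H Γ : Mat n) (ρ : Op n) :
    secondMoments (quadGen H Γ 0 ρ)
      = (Complex.I / 2) • (matE n * Hᵀ * secondMoments ρ - (secondMoments ρ)ᵀ * H * matE n
          + matE n * H * (secondMoments ρ)ᵀ - secondMoments ρ * Hᵀ * matE n)
        + (1 / 2 : ℂ) • ((secondMoments ρ)ᵀ * Γᵀ * matE n - matE n * Γ * secondMoments ρ
          + matE n * Γᵀ * (secondMoments ρ)ᵀ - secondMoments ρ * Γ * matE n) := by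
  set D := secondMoments ρ with hD
  have hDa : ∀ i j, (cc i * cc j * ρ).trace = D i j := fun i j => rfl
  have e1 : ∀ (M R : Mat n) i j, (matE n * Mᵀ * R) i j
      = ∑ a, ∑ b, M a b * (matE n b i * R a j) := by
    intro M R i j
    simp only [Matrix.mul_apply, Finset.sum_mul, transpose_apply]
    exact Finset.sum_congr rfl fun a _ => Finset.sum_congr rfl fun b _ => by
      rw [matE_symm i b]; ring
  have e2 : ∀ (M R : Mat n) i j, (matE n * M * R) i j = ∑ a, ∑ b, M a b * (matE n a i * R b j) := by
    intro M R i j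
    rw [← transpose_transpose M, e1, Finset.sum_comm]; rfl
  have e3 : ∀ (M R : Mat n) i j, (R * M * matE n) i j = ∑ a, ∑ b, M a b * (matE n b j * R i a) := by
    intro M R i j
    rw [← transpose_transpose (R * M * matE n), transpose_apply, transpose_mul, transpose_mul,
      matE_transpose, ← Matrix.mul_assoc, e1]; rfl
  have e4 : ∀ (M R : Mat n) i j, (R * Mᵀ * matE n) i j
      = ∑ a, ∑ b, M a b * (matE n a j * R i b) := by
    intro M R i j
    rw [e3, Finset.sum_comm]; rfl
  ext i j
  have hL : quadGen H Γ 0 ρ = (-Complex.I / 2) • (quadForm H * ρ - ρ * quadForm H)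
      + (∑ i, ∑ j, Γ i j • (cc i * ρ * cc j) - (1 / 2 : ℂ) • (quadForm Γᵀ * ρ)
        - (1 / 2 : ℂ) • (ρ * quadForm Γᵀ)) := by
    simp only [quadGen, LinearMap.coe_mk, AddHom.coe_mk, linForm_zero, add_zero, Matrix.smul_mul,
      Matrix.mul_smul]
    module
  have hs : secondMoments (quadGen H Γ 0 ρ) i j = (cc i * cc j * quadGen H Γ 0 ρ).trace := rfl
  rw [hs, hL, Matrix.mul_add, Matrix.mul_smul, trace_add, trace_smul, trace_mul_quadForm_comm,
    trace_mul_dissipator]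
  have hn : ∀ a b, cc i * cc j * (cc a * cc b) - cc a * cc b * (cc i * cc j)
    = -(cc a * cc b * (cc i * cc j) - cc i * cc j * (cc a * cc b)) := fun a b => by abel
  simp only [hn, pair_commutator, pair_dissipator, Matrix.neg_mul, Matrix.sub_mul, Matrix.add_mul,
    Matrix.smul_mul, trace_neg, trace_add, trace_sub, trace_smul, hDa, Matrix.add_apply,
    Matrix.sub_apply, Matrix.smul_apply, e1, e4, smul_eq_mul]
  simp only [e2, e3, transpose_apply, ← Finset.sum_sub_distrib, ← Finset.sum_add_distrib,
    Finset.mul_sum]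
  refine Finset.sum_congr rfl fun a _ => Finset.sum_congr rfl fun b _ => ?_
  rw [matE_symm j a, matE_symm i a]
  ring

theorem secondMoments_add_transpose (ρ : Op n) :
    secondMoments ρ + (secondMoments ρ)ᵀ = ρ.trace • matE n := by
  ext i j
  simp only [Matrix.add_apply, transpose_apply, secondMoments, of_apply, Matrix.smul_apply]
  rw [← trace_add, ← Matrix.add_mul, cc_anticomm, Matrix.smul_mul, Matrix.one_mul, trace_smul,
    smul_eq_mul, smul_eq_mul, mul_comm]

/-- The anticommutation relations fix the symmetric part of the second moments. In the equation of
motion this fixed part is what becomes the inhomogeneity `noise Γ`. -/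
theorem secondMoments_eq (ρ : Op n) :
    secondMoments ρ = anticov ρ + (ρ.trace / 2) • matE n := by
  have h := secondMoments_add_transpose ρ
  rw [div_eq_mul_inv, mul_comm, mul_smul, ← h, anticov]
  module

theorem anticov_transpose (ρ : Op n) : (anticov ρ)ᵀ = -anticov ρ := by
  rw [anticov, transpose_smul, transpose_sub, transpose_transpose]
  module

theorem anticov_quadGen {H : Mat n} (Γ : Mat n) (hH : Hᵀ = -H) (ρ : Op n) :
    anticov (quadGen H Γ 0 ρ)
      = drift H Γ * anticov ρ + anticov ρ * (drift H Γ)ᵀ + ρ.trace • noise Γ := by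
  have h1 : (secondMoments ρ)ᵀ = -anticov ρ + (ρ.trace / 2) • matE n := by
    rw [secondMoments_eq, transpose_add, anticov_transpose, transpose_smul, matE_transpose]
  have h0 := secondMoments_quadGen H Γ ρ
  rw [h1, secondMoments_eq ρ, hH] at h0
  have h2 : secondMoments (quadGen H Γ 0 ρ)
      = drift H Γ * anticov ρ + anticov ρ * (drift H Γ)ᵀ + ρ.trace • noise Γ := by
    rw [h0, drift_transpose Γ hH, drift, noise]
    simp only [Matrix.mul_add, Matrix.add_mul, Matrix.mul_sub, Matrix.sub_mul, Matrix.mul_smul,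
      Matrix.smul_mul, Matrix.mul_neg, Matrix.neg_mul, smul_add, smul_sub, smul_neg, smul_smul,
      neg_smul, Matrix.mul_assoc]
    module
  -- The derivative of the second moments is already antisymmetric, so antisymmetrizing leaves it
  -- unchanged.
  have h3 : (drift H Γ * anticov ρ + anticov ρ * (drift H Γ)ᵀ + ρ.trace • noise Γ)ᵀ
      = -(drift H Γ * anticov ρ + anticov ρ * (drift H Γ)ᵀ + ρ.trace • noise Γ) := by
    have hn : (noise Γ)ᵀ = -noise Γ := by
      simp only [noise, transpose_mul, transpose_smul, transpose_sub, transpose_transpose,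
        matE_transpose, Matrix.mul_sub, Matrix.sub_mul, Matrix.mul_smul, Matrix.smul_mul, smul_sub,
        Matrix.mul_assoc]
      abel
    simp only [transpose_add, transpose_mul, transpose_smul, transpose_transpose,
      anticov_transpose, hn, Matrix.neg_mul, Matrix.mul_neg, smul_neg]
    abel
  rw [anticov, h2, h3]
  module

end Moments

/-! ### Integration of the moment equation -/

section MomentEvolution
open scoped Matrix.Norms.L2Operator
variable {n : ℕ}

/-- The Lyapunov operator `A ↦ X A + A Xᵀ`. -/
noncomputable def lyapunov (X : Mat n) : Mat n →ₗ[ℝ] Mat n :=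
  LinearMap.mulLeft ℝ X + LinearMap.mulRight ℝ Xᵀ

/-- The anticovariance matrix as a linear map. -/
noncomputable def anticovLinear (n : ℕ) : Op n →ₗ[ℝ] Mat n where
  toFun := anticov
  map_add' ρ ρ' := by
    ext i j
    simp [anticov, secondMoments, Matrix.mul_add]
    ring
  map_smul' r ρ := by
    ext i j
    simp [anticov, secondMoments]
    ring

theorem anticov_superExp {H : Mat n} (Γ : Mat n) (hH : Hᵀ = -H) (t : ℝ) {ρ : Op n}
    (hρ : ρ.trace = 1) : anticov (superExp (quadGen H Γ 0) t ρ) = evolve H Γ (anticov ρ) t := by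
  have h := linear_ode_unique (lyapunov (drift H Γ)) (noise Γ)
    (f := fun s => anticov (superExp (quadGen H Γ 0) s ρ)) (g := evolve H Γ (anticov ρ))
    (fun s => ?_) (fun s => hasDerivAt_evolve Γ _ hH s)
    (by rw [evolve_zero Γ _ hH, superExp_zero])
  · exact congrFun h t
  · refine ((LinearMap.toContinuousLinearMap (anticovLinear n)).hasFDerivAt.comp_hasDerivAt s
      (hasDerivAt_superExp (quadGen H Γ 0) ρ s)).congr_deriv ?_
    refine (anticov_quadGen Γ hH _).trans ?_
    rw [trace_superExp, hρ, one_smul]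
    rfl

end MomentEvolution

/-! ### Derivations and exponentials of nilpotent elements -/

section NilpotentExp

theorem pow_succ_mul_of_commutator {A : Type*} [Ring A] {a b z : A}
    (h : a * b = b * a + z) (hz : Commute a z) (k : ℕ) :
    a ^ (k + 1) * b = b * a ^ (k + 1) + (k + 1 : ℕ) • (z * a ^ k) := by
  induction k with
  | zero => simpa using h
  | succ k ih =>
    have hz' : a ^ (k + 1) * z = z * a ^ (k + 1) := (hz.pow_left (k + 1)).eq
    rw [pow_succ a (k + 1), mul_assoc, h, mul_add, ← mul_assoc, ih, add_mul, hz', smul_mul_assoc,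
      mul_assoc, mul_assoc, ← pow_succ, succ_nsmul _ (k + 1), ← pow_succ]
    abel

variable {A : Type*} [Ring A] [Module ℚ A]

/-- The derivation replaces one factor `a` by `b`. Moving `b` to the far left costs one `z` for each
`a` that it passes, hence `(k+2)(k+1)/2` copies in total. -/
theorem derivation_pow {D : A →+ A} (hD : ∀ x y, D (x * y) = D x * y + x * D y) {a b z : A}
    (hb : D a = b) (h : a * b = b * a + z) (hz : Commute a z) (k : ℕ) :
    D (a ^ (k + 2)) = ((k + 2 : ℕ) : ℚ) • (b * a ^ (k + 1))
      + (((k + 2 : ℕ) : ℚ) * ((k + 1 : ℕ) : ℚ) / 2) • (z * a ^ k) := by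
  induction k with
  | zero =>
    rw [pow_two, hD, hb, h]
    simp only [zero_add, pow_one, pow_zero, mul_one, Nat.cast_one]
    rw [show ((2 : ℕ) : ℚ) / 2 = 1 by norm_num]
    module
  | succ k ih =>
    rw [pow_succ, hD, ih, hb, show k + 2 = k + 1 + 1 from rfl,
      pow_succ_mul_of_commutator h hz (k + 1), add_mul, smul_mul_assoc, smul_mul_assoc, mul_assoc,
      mul_assoc, ← pow_succ, ← pow_succ, ← Nat.cast_smul_eq_nsmul ℚ]
    push_cast
    module

/-- If `D` is a derivation and `z = [a, D a]` commutes with `a`, then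
`D e^a = (D a + z / 2) e^a`. -/
theorem derivation_nilpotentExp {D : A →+ A} (hD : ∀ x y, D (x * y) = D x * y + x * D y)
    {a b z : A} (hb : D a = b) (h : a * b = b * a + z) (hz : Commute a z) (ha : IsNilpotent a) :
    D (IsNilpotent.exp a) = (b + (1 / 2 : ℚ) • z) * IsNilpotent.exp a := by
  obtain ⟨N, hN⟩ := ha
  have hN1 : a ^ (N + 1) = 0 := by rw [pow_succ, hN, zero_mul]
  have hN2 : a ^ (N + 2) = 0 := by rw [pow_succ, hN1, zero_mul]
  have h1 : D 1 = 0 := by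
    have := hD 1 1
    rw [mul_one, mul_one, one_mul] at this
    exact left_eq_add.mp this
  have hD2 : ∀ k : ℕ, D (((k + 2).factorial : ℚ)⁻¹ • a ^ (k + 2))
      = b * (((k + 1).factorial : ℚ)⁻¹ • a ^ (k + 1))
        + ((1 / 2 : ℚ) • z) * (((k.factorial : ℚ)⁻¹) • a ^ k) := by
    intro k
    have hk : (k.factorial : ℚ) ≠ 0 := by positivity
    rw [map_rat_smul, derivation_pow hD hb h hz, mul_smul_comm, smul_mul_smul_comm, smul_add,
      smul_smul, smul_smul]
    congr 2
    · rw [Nat.factorial_succ (k + 1)]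
      push_cast
      have : (((k + 1).factorial : ℕ) : ℚ) ≠ 0 := by positivity
      field_simp
      ring
    · rw [Nat.factorial_succ (k + 1), Nat.factorial_succ k]
      push_cast
      field_simp
      ring
  -- The same exponential truncated at three lengths: `D` lowers the degree by one in the `b` part
  -- and by two in the `z` part, and the three sums then match term by term.
  have e1 : IsNilpotent.exp a = _ := IsNilpotent.exp_eq_sum hN
  have e2 : IsNilpotent.exp a = _ := IsNilpotent.exp_eq_sum hN1
  have e3 : IsNilpotent.exp a = _ := IsNilpotent.exp_eq_sum hN2
  calc D (IsNilpotent.exp a)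
      = ∑ k ∈ Finset.range N, D (((k + 2).factorial : ℚ)⁻¹ • a ^ (k + 2)) + b := by
        rw [e3, map_sum, Finset.sum_range_succ', Finset.sum_range_succ']
        simp [h1, hb]
    _ = b * IsNilpotent.exp a + ((1 / 2 : ℚ) • z) * IsNilpotent.exp a := by
        nth_rewrite 1 [e2]
        rw [e1, Finset.sum_congr rfl fun k _ => hD2 k, Finset.sum_add_distrib, Finset.mul_sum,
          Finset.mul_sum, Finset.sum_range_succ' _ N]
        simp only [pow_zero, Nat.factorial_zero, Nat.cast_one, inv_one, one_smul, mul_one]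
        abel
    _ = _ := (add_mul _ _ _).symm

end NilpotentExp

/-! ### The Grassmann algebra -/

section Grassmann
variable {n : ℕ}

/-- The span of the Grassmann generators. -/
noncomputable abbrev genSpan (n : ℕ) : Submodule ℂ (Grass n) :=
  LinearMap.range (ExteriorAlgebra.ι ℂ (M := Idx n → ℂ))

/-- The exterior power of degree `2n + 1` over a space of dimension `2n` vanishes. -/
theorem genSpan_pow_eq_bot : genSpan n ^ (2 * n + 1) = ⊥ := by
  have h := exteriorPower.finrank_eq (R := ℂ) (M := Idx n → ℂ) (2 * n + 1)
  rw [Module.finrank_fintype_fun_eq_card, Nat.choose_eq_zero_of_lt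
    (by rw [Fintype.card_sum, Fintype.card_fin]; omega)] at h
  exact Submodule.finrank_eq_zero.1 h

theorem theta_mem (i : Idx n) : theta i ∈ genSpan n := LinearMap.mem_range_self _ _

theorem theta_mul_comm (i j : Idx n) : theta i * theta j = -(theta j * theta i) :=
  eq_neg_of_add_eq_zero_left (ExteriorAlgebra.ι_add_mul_swap _ _)

/-- The quadratic form `𝛉^T K 𝛉 / 2`. -/
noncomputable def quadTheta (K : Mat n) : Grass n :=
  (1 / 2 : ℂ) • ∑ i, ∑ j, K i j • (theta i * theta j)

theorem gaussExp_eq (K : Mat n) : gaussExp K = IsNilpotent.exp (quadTheta K) := rfl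

theorem quadTheta_mem (K : Mat n) : quadTheta K ∈ genSpan n ^ 2 := by
  rw [pow_two]
  exact Submodule.smul_mem _ _ (Submodule.sum_mem _ fun i _ => Submodule.sum_mem _ fun j _ =>
    Submodule.smul_mem _ _ (Submodule.mul_mem_mul (theta_mem i) (theta_mem j)))

theorem quadTheta_pow (K : Mat n) : quadTheta K ^ (2 * n + 1) = 0 := by
  have h := Submodule.pow_mem_pow _ (quadTheta_mem K) (2 * n + 1)
  rw [← pow_mul, mul_comm, pow_mul, genSpan_pow_eq_bot, Submodule.bot_pow two_ne_zero] at h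
  exact (Submodule.mem_bot ℂ).1 h

theorem quadTheta_add (K K' : Mat n) : quadTheta (K + K') = quadTheta K + quadTheta K' := by
  simp only [quadTheta, Matrix.add_apply, add_smul, Finset.sum_add_distrib, smul_add]

theorem quadTheta_smul (r : ℂ) (K : Mat n) : quadTheta (r • K) = r • quadTheta K := by
  simp only [quadTheta, Matrix.smul_apply, smul_assoc, ← Finset.smul_sum]
  rw [smul_comm]

theorem theta_pair_commute (i j k l : Idx n) :
    Commute (theta i * theta j) (theta k * theta l) := by
  have h : ∀ a b : Idx n, ∀ x : Grass n, theta a * (theta b * x) = -(theta b * (theta a * x)) :=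
    fun a b x => by rw [← mul_assoc, theta_mul_comm, neg_mul, mul_assoc]
  change theta i * theta j * (theta k * theta l) = theta k * theta l * (theta i * theta j)
  rw [mul_assoc, mul_assoc, h j k, theta_mul_comm j l]
  simp only [mul_neg, neg_neg]
  rw [h i k, h i l]
  simp only [mul_neg, neg_neg]

theorem quadTheta_commute (K K' : Mat n) : Commute (quadTheta K) (quadTheta K') :=
  Commute.smul_left (Commute.smul_right
    (Commute.sum_left _ _ _ fun i _ => Commute.sum_left _ _ _ fun j _ =>
      Commute.sum_right _ _ _ fun k _ => Commute.sum_right _ _ _ fun l _ =>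
        ((theta_pair_commute i j k l).smul_left _).smul_right _) _) _

/-- The algebra morphism `x ↦ x + ε δ x` for the derivation `δ` extending `X` on generators. -/
noncomputable def derivLift (X : Mat n) : Grass n →ₐ[ℂ] TrivSqZeroExt (Grass n) (Grass n) :=
  ExteriorAlgebra.lift ℂ ⟨(TrivSqZeroExt.inlAlgHom ℂ (Grass n) (Grass n)).toLinearMap
      ∘ₗ ExteriorAlgebra.ι ℂ
    + (TrivSqZeroExt.inrHom (Grass n) (Grass n)).restrictScalars ℂ
      ∘ₗ ExteriorAlgebra.ι ℂ ∘ₗ Matrix.mulVecLin X, fun v => by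
    refine TrivSqZeroExt.ext ?_ ?_
    · simp
    -- The `ε`-part of the square is the anticommutator of the generators `v` and `Xv`, which is
    -- zero.
    · simp [TrivSqZeroExt.snd_mul]⟩

theorem derivLift_ι (X : Mat n) (v : Idx n → ℂ) :
    derivLift X (ExteriorAlgebra.ι ℂ v)
      = TrivSqZeroExt.inl (ExteriorAlgebra.ι ℂ v)
        + TrivSqZeroExt.inr (ExteriorAlgebra.ι ℂ (X *ᵥ v)) := by
  rw [derivLift, ExteriorAlgebra.lift_ι_apply]
  rfl

theorem derivLift_fst (X : Mat n) (x : Grass n) : (derivLift X x).fst = x := by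
  have h : (TrivSqZeroExt.fstHom ℂ (Grass n) (Grass n)).comp (derivLift X) = AlgHom.id ℂ _ := by
    refine ExteriorAlgebra.hom_ext (LinearMap.ext fun v => ?_)
    change (derivLift X (ExteriorAlgebra.ι ℂ v)).fst = _
    rw [derivLift_ι]
    simp
  exact congrArg (fun f : Grass n →ₐ[ℂ] Grass n => f x) h

/-- The derivation of the Grassmann algebra extending the linear map `X` of the generators. -/
noncomputable def grassDeriv (X : Mat n) : Grass n →ₗ[ℂ] Grass n :=
  (TrivSqZeroExt.sndHom (Grass n) (Grass n)).restrictScalars ℂ ∘ₗ (derivLift X).toLinearMap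

theorem grassDeriv_mul (X : Mat n) (x y : Grass n) :
    grassDeriv X (x * y) = grassDeriv X x * y + x * grassDeriv X y := by
  change (derivLift X (x * y)).snd = (derivLift X x).snd * y + x * (derivLift X y).snd
  rw [map_mul, TrivSqZeroExt.snd_mul, derivLift_fst, derivLift_fst, add_comm]
  rfl

theorem grassDeriv_algebraMap (X : Mat n) (r : ℂ) :
    grassDeriv X (algebraMap ℂ (Grass n) r) = 0 := by
  change (derivLift X (algebraMap ℂ (Grass n) r)).snd = 0
  rw [AlgHom.commutes]
  rfl

theorem grassDeriv_theta (X : Mat n) (i : Idx n) :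
    grassDeriv X (theta i) = ∑ a, X a i • theta a := by
  change (derivLift X (theta i)).snd = _
  rw [theta, derivLift_ι, TrivSqZeroExt.snd_add, TrivSqZeroExt.snd_inl, TrivSqZeroExt.snd_inr,
    zero_add, Matrix.mulVec_single_one]
  have : X.col i = ∑ a, X a i • (Pi.single a 1 : Idx n → ℂ) := by
    ext b
    simp [Finset.sum_apply, Pi.single_apply]
  rw [this, map_sum]
  simp only [map_smul]
  rfl

theorem sum_smul_mul_left {V : Type*} [AddCommGroup V] [Module ℂ V] (X K : Mat n)
    (f : Idx n → Idx n → V) :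
    ∑ i, ∑ j, K i j • ∑ a, X a i • f a j = ∑ i, ∑ j, (X * K) i j • f i j := by
  simp only [Matrix.mul_apply, Finset.sum_smul, Finset.smul_sum, smul_smul]
  rw [Finset.sum_comm, Finset.sum_congr rfl fun j _ => Finset.sum_comm, Finset.sum_comm]
  simp only [mul_comm]

theorem sum_smul_mul_right {V : Type*} [AddCommGroup V] [Module ℂ V] (X K : Mat n)
    (f : Idx n → Idx n → V) :
    ∑ i, ∑ j, K i j • ∑ b, X b j • f i b = ∑ i, ∑ j, (K * Xᵀ) i j • f i j := by
  simp only [Matrix.mul_apply, Finset.sum_smul, Finset.smul_sum, smul_smul, transpose_apply]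
  exact Finset.sum_congr rfl fun i _ => Finset.sum_comm

theorem grassDeriv_quadTheta (X K : Mat n) :
    grassDeriv X (quadTheta K) = quadTheta (X * K + K * Xᵀ) := by
  have h1 := sum_smul_mul_left X K fun i j => theta i * theta j
  have h2 := sum_smul_mul_right X K fun i j => theta i * theta j
  rw [quadTheta_add]
  simp only [quadTheta, map_smul, map_sum, grassDeriv_mul, grassDeriv_theta, smul_add,
    Finset.sum_add_distrib, Finset.sum_mul, Finset.mul_sum, smul_mul_assoc, mul_smul_comm, ← h1,
    ← h2]

theorem grassDeriv_gaussExp (X K : Mat n) :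
    grassDeriv X (gaussExp K) = quadTheta (X * K + K * Xᵀ) * gaussExp K := by
  have h := derivation_nilpotentExp (D := (grassDeriv X).toAddMonoidHom) (grassDeriv_mul X)
    (a := quadTheta K) (b := quadTheta (X * K + K * Xᵀ)) (z := 0) (grassDeriv_quadTheta X K)
    (by rw [add_zero]; exact quadTheta_commute _ _) (Commute.zero_right _) ⟨_, quadTheta_pow K⟩
  rw [smul_zero, add_zero] at h
  exact h

end Grassmann

/-! ### The algebra generated by the operators and the Grassmann variables -/

section CARGrass
variable {n : ℕ}

/-- The element `ω ⊗ X` of the CAR-Grassmann algebra. -/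
noncomputable def gmul (ω : Grass n) (X : Op n) : CARGrass n := Matrix.of fun x y => X x y • ω

theorem gmul_apply (ω : Grass n) (X : Op n) (x y : Conf n) : gmul ω X x y = X x y • ω := rfl

/-- The tensor product is ungraded; all signs between Grassmann variables and operators come from
the parity factor in `liftTheta`. -/
theorem gmul_mul (ω ω' : Grass n) (X Y : Op n) :
    gmul ω X * gmul ω' Y = gmul (ω * ω') (X * Y) := by
  ext x y
  simp only [gmul_apply, Matrix.mul_apply, Finset.sum_smul, smul_mul_smul_comm]

theorem gmul_neg (ω : Grass n) (X : Op n) : gmul ω (-X) = -gmul ω X := by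
  ext x y; simp [gmul_apply]

theorem neg_gmul (ω : Grass n) (X : Op n) : gmul (-ω) X = -gmul ω X := by
  ext x y; simp [gmul_apply]

theorem liftOp_eq (X : Op n) : liftOp X = gmul 1 X := by
  ext x y
  simp [liftOp, gmul_apply, Algebra.algebraMap_eq_smul_one]

theorem liftTheta_eq (i : Idx n) : liftTheta i = gmul (theta i) (parity n) := rfl

theorem liftOp_mul (X Y : Op n) : liftOp (X * Y) = liftOp X * liftOp Y := by
  rw [liftOp_eq, liftOp_eq, liftOp_eq, gmul_mul, mul_one]

theorem liftOp_add (X Y : Op n) : liftOp (X + Y) = liftOp X + liftOp Y := by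
  ext x y; simp [liftOp]

theorem liftOp_smul (r : ℂ) (X : Op n) : liftOp (r • X) = r • liftOp X := by
  ext x y; simp [liftOp, Algebra.algebraMap_eq_smul_one, mul_smul]

theorem liftOp_one : liftOp (1 : Op n) = 1 :=
  Matrix.map_one _ (map_zero _) (map_one _)

theorem liftOp_cc_anticomm (i j : Idx n) :
    liftOp (cc i) * liftOp (cc j) + liftOp (cc j) * liftOp (cc i)
      = matE n i j • (1 : CARGrass n) := by
  rw [← liftOp_mul, ← liftOp_mul, ← liftOp_add, cc_anticomm, liftOp_smul, liftOp_one]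

theorem liftOp_mul_liftTheta (i j : Idx n) :
    liftOp (cc i) * liftTheta j = -(liftTheta j * liftOp (cc i)) := by
  rw [liftOp_eq, liftTheta_eq, gmul_mul, gmul_mul, mul_one, one_mul, cc_mul_parity, gmul_neg]

theorem liftTheta_mul_liftTheta (i j : Idx n) :
    liftTheta i * liftTheta j = gmul (theta i * theta j) 1 := by
  rw [liftTheta_eq, liftTheta_eq, gmul_mul, parity_mul_self]

theorem liftTheta_anticomm (i j : Idx n) :
    liftTheta i * liftTheta j = -(liftTheta j * liftTheta i) := by
  rw [liftTheta_mul_liftTheta, liftTheta_mul_liftTheta, theta_mul_comm, neg_gmul]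

theorem gmul_one_mul_apply (ω : Grass n) (Y : CARGrass n) (x y : Conf n) :
    (gmul ω 1 * Y) x y = ω * Y x y := by
  simp [Matrix.mul_apply, gmul_apply, Matrix.one_apply]

/-! #### Nilpotency -/

theorem pow_apply_mem {J : Submodule ℂ (Grass n)} {Y : CARGrass n} (hY : ∀ x y, Y x y ∈ J)
    (k : ℕ) (x y : Conf n) : (Y ^ k) x y ∈ J ^ k := by
  induction k generalizing x y with
  | zero =>
    rw [pow_zero, pow_zero, Matrix.one_apply]
    split_ifs
    · exact Submodule.one_le.1 le_rfl
    · exact Submodule.zero_mem _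
  | succ k ih =>
    rw [pow_succ, pow_succ, Matrix.mul_apply]
    exact Submodule.sum_mem _ fun z _ => Submodule.mul_mem_mul (ih x z) (hY z y)

theorem thetaEc_eq :
    thetaEc n = ∑ i, ∑ j, matE n i j • gmul (theta i) (parity n * cc j) := by
  simp only [thetaEc, liftTheta_eq, liftOp_eq, gmul_mul, mul_one]

theorem isNilpotent_thetaEc : IsNilpotent (thetaEc n) := by
  refine ⟨2 * n + 1, ?_⟩
  ext x y
  have h : ∀ x y, thetaEc n x y ∈ genSpan n := fun x y => by
    simp only [thetaEc_eq, Matrix.sum_apply, Matrix.smul_apply, gmul_apply]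
    exact Submodule.sum_mem _ fun i _ => Submodule.sum_mem _ fun j _ =>
      Submodule.smul_mem _ _ (Submodule.smul_mem _ _ (theta_mem i))
  have := pow_apply_mem h (2 * n + 1) x y
  rw [genSpan_pow_eq_bot] at this
  exact (Submodule.mem_bot ℂ).1 this

/-! #### Commutation relations of `𝛉^T E 𝔠` -/

theorem thetaEc_mul_liftTheta (k : Idx n) :
    thetaEc n * liftTheta k = liftTheta k * thetaEc n := by
  simp only [thetaEc, Finset.sum_mul, Finset.mul_sum, smul_mul_assoc, mul_smul_comm]
  refine Finset.sum_congr rfl fun i _ => Finset.sum_congr rfl fun j _ => ?_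
  rw [mul_assoc, liftOp_mul_liftTheta, mul_neg, ← mul_assoc, liftTheta_anticomm, neg_mul, neg_neg,
    mul_assoc]

/-- The anticommutator of `𝔠_j` and `𝔠_k` contributes a second `E`, and `E² = 1` leaves `θ_k`. -/
theorem thetaEc_mul_liftOp (k : Idx n) :
    thetaEc n * liftOp (cc k) = liftOp (cc k) * thetaEc n + liftTheta k := by
  have h1 : ∀ i j, liftTheta i * liftOp (cc j) * liftOp (cc k)
      = liftOp (cc k) * (liftTheta i * liftOp (cc j)) + matE n j k • liftTheta i := fun i j => by
    rw [← mul_assoc, liftOp_mul_liftTheta, neg_mul, mul_assoc, mul_assoc,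
      eq_sub_of_add_eq (liftOp_cc_anticomm j k), mul_sub, mul_smul_comm, mul_one]
    abel
  have h2 : ∑ i, ∑ j, matE n i j • matE n j k • (liftTheta i : CARGrass n) = liftTheta k := by
    have : ∀ i, ∑ j, matE n i j • matE n j k • (liftTheta i : CARGrass n)
        = (1 : Mat n) i k • liftTheta i := fun i => by
      rw [← matE_mul_self, Matrix.mul_apply, Finset.sum_smul]
      simp only [smul_smul]
    rw [Finset.sum_congr rfl fun i _ => this i]
    simp [Matrix.one_apply]
  simp only [thetaEc, Finset.sum_mul, smul_mul_assoc, h1, smul_add, Finset.sum_add_distrib, h2,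
    Finset.mul_sum, mul_smul_comm]

/-- The generating operator `e^{𝛉^T E 𝔠}` of the characteristic function. -/
noncomputable def weyl (n : ℕ) : CARGrass n := IsNilpotent.exp (thetaEc n)

/-- Displacement relation: `[𝛉ᵀE𝔠, 𝔠_k] = θ_k` commutes with the exponent, so the expansion stops at
first order. -/
theorem weyl_mul_liftOp (k : Idx n) :
    weyl n * liftOp (cc k) = (liftOp (cc k) + liftTheta k) * weyl n := by
  let D : CARGrass n →+ CARGrass n :=
    AddMonoidHom.mulRight (liftOp (cc k)) - AddMonoidHom.mulLeft (liftOp (cc k))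
  have hD : ∀ Y, D Y = Y * liftOp (cc k) - liftOp (cc k) * Y := fun _ => rfl
  have h := derivation_nilpotentExp (D := D) (a := thetaEc n) (b := liftTheta k) (z := 0)
    (fun x y => by simp only [hD]; noncomm_ring)
    (by rw [hD, thetaEc_mul_liftOp, add_sub_cancel_left])
    (by rw [add_zero, thetaEc_mul_liftTheta]) (Commute.zero_right _) isNilpotent_thetaEc
  rw [smul_zero, add_zero, hD, sub_eq_iff_eq_add] at h
  rw [weyl, h]
  noncomm_ring

/-! #### Derivations of the Grassmann variables -/

/-- The entrywise action of the derivation of the Grassmann algebra. -/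
noncomputable def matDeriv (X : Mat n) : CARGrass n →ₗ[ℂ] CARGrass n := (grassDeriv X).mapMatrix

theorem matDeriv_apply (X : Mat n) (Y : CARGrass n) (x y : Conf n) :
    matDeriv X Y x y = grassDeriv X (Y x y) := rfl

theorem matDeriv_mul (X : Mat n) (Y Z : CARGrass n) :
    matDeriv X (Y * Z) = matDeriv X Y * Z + Y * matDeriv X Z := by
  ext x y
  simp only [matDeriv_apply, Matrix.add_apply, Matrix.mul_apply, map_sum, grassDeriv_mul,
    Finset.sum_add_distrib]

theorem matDeriv_liftOp (X : Mat n) (Y : Op n) : matDeriv X (liftOp Y) = 0 := by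
  ext x y
  exact grassDeriv_algebraMap X _

theorem matDeriv_liftTheta (X : Mat n) (i : Idx n) :
    matDeriv X (liftTheta i) = ∑ a, X a i • liftTheta a := by
  ext x y
  simp only [matDeriv_apply, liftTheta_eq, gmul_apply, map_smul, grassDeriv_theta,
    Matrix.sum_apply, Matrix.smul_apply, Finset.smul_sum]
  exact Finset.sum_congr rfl fun a _ => smul_comm _ _ _

/-- The mixed quadratic form `𝛉^T M 𝔠`. -/
noncomputable def mixedForm (M : Mat n) : CARGrass n :=
  ∑ i, ∑ j, M i j • (liftTheta i * liftOp (cc j))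

theorem matDeriv_thetaEc (X : Mat n) : matDeriv X (thetaEc n) = mixedForm (X * matE n) := by
  rw [mixedForm, ← sum_smul_mul_left X (matE n) fun i j => liftTheta i * liftOp (cc j)]
  simp only [thetaEc, map_sum, map_smul, matDeriv_mul, matDeriv_liftOp, mul_zero, add_zero,
    matDeriv_liftTheta, Finset.sum_mul, smul_mul_assoc]

theorem gmul_quadTheta (M : Mat n) :
    gmul (quadTheta M) 1 = (1 / 2 : ℂ) • ∑ i, ∑ j, M i j • (liftTheta i * liftTheta j) := by
  ext x y
  simp only [liftTheta_mul_liftTheta, gmul_apply, quadTheta, Matrix.smul_apply, Matrix.sum_apply]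
  rw [smul_comm]
  simp only [Finset.smul_sum]
  simp only [smul_comm ((1 : Op n) x y)]

theorem commute_thetaEc_gmul (M : Mat n) :
    Commute (thetaEc n) (∑ i, ∑ j, M i j • (liftTheta i * liftTheta j)) :=
  Commute.sum_right _ _ _ fun i _ => Commute.sum_right _ _ _ fun j _ =>
    ((show Commute (thetaEc n) (liftTheta i) from thetaEc_mul_liftTheta i).mul_right
      (thetaEc_mul_liftTheta j)).smul_right _

theorem thetaEc_mul_mixedForm (M : Mat n) :
    thetaEc n * mixedForm M
      = mixedForm M * thetaEc n + ∑ i, ∑ j, M i j • (liftTheta i * liftTheta j) := by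
  simp only [mixedForm, Finset.mul_sum, Finset.sum_mul, mul_smul_comm, smul_mul_assoc,
    ← Finset.sum_add_distrib, ← smul_add]
  refine Finset.sum_congr rfl fun i _ => Finset.sum_congr rfl fun j _ => ?_
  rw [← mul_assoc, thetaEc_mul_liftTheta, mul_assoc, thetaEc_mul_liftOp, mul_add, mul_assoc]

/-- Here the exponent and its derivative fail to commute; their commutator is a form in `𝛉` alone,
which commutes with the exponent. Read backwards, the formula replaces an insertion of `𝛉ᵀM𝔠` under
the trace by a derivation acting on the characteristic function. -/
theorem matDeriv_weyl (X : Mat n) :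
    matDeriv X (weyl n)
      = (mixedForm (X * matE n) + gmul (quadTheta (X * matE n)) 1) * weyl n := by
  have h := derivation_nilpotentExp (D := (matDeriv X).toAddMonoidHom) (matDeriv_mul X)
    (a := thetaEc n) (matDeriv_thetaEc X) (thetaEc_mul_mixedForm _) (commute_thetaEc_gmul _)
    isNilpotent_thetaEc
  rw [gmul_quadTheta]
  have h2 : ∀ Y : CARGrass n, (1 / 2 : ℂ) • Y = (1 / 2 : ℚ) • Y := fun Y => by
    rw [← Rat.cast_smul_eq_qsmul ℂ]
    norm_num
  rw [h2]
  exact h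

/-! #### The characteristic function of `𝓛 ρ` -/

/-- Cyclicity of the trace fails over noncommuting coefficients; it holds here because the entries
of `liftOp X` are scalars. -/
theorem trace_liftOp_mul_comm (X : Op n) (Y : CARGrass n) :
    (liftOp X * Y).trace = (Y * liftOp X).trace := by
  simp only [Matrix.trace, Matrix.diag_apply, Matrix.mul_apply, liftOp, Matrix.map_apply]
  rw [Finset.sum_comm]
  exact Finset.sum_congr rfl fun x _ => Finset.sum_congr rfl fun y _ => Algebra.commutes _ _

theorem charFun_eq (ρ : Op n) : charFun ρ = (liftOp ρ * weyl n).trace := rfl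

theorem grassDeriv_charFun (X : Mat n) (ρ : Op n) :
    grassDeriv X (charFun ρ)
      = (liftOp ρ * ((mixedForm (X * matE n) + gmul (quadTheta (X * matE n)) 1)
          * weyl n)).trace := by
  rw [← matDeriv_weyl, charFun_eq]
  have : ∀ Y : CARGrass n, grassDeriv X Y.trace = (matDeriv X Y).trace := fun Y => by
    simp only [Matrix.trace, Matrix.diag_apply, map_sum, matDeriv_apply]
  rw [this, matDeriv_mul, matDeriv_liftOp, zero_mul, zero_add]

theorem trace_liftOp_gmul (ω : Grass n) (ρ : Op n) :
    (liftOp ρ * (gmul ω 1 * weyl n)).trace = ω * charFun ρ := by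
  rw [charFun_eq, ← mul_assoc, liftOp_eq, gmul_mul, one_mul, mul_one]
  have : gmul ω ρ = gmul ω 1 * gmul 1 ρ := by rw [gmul_mul, mul_one, one_mul]
  rw [this, mul_assoc]
  simp only [Matrix.trace, Matrix.diag_apply, gmul_one_mul_apply, Finset.mul_sum]

theorem charFun_jump (a b : Idx n) (ρ : Op n) :
    charFun (cc a * ρ * cc b)
      = (liftOp ρ * (liftOp (cc b) * (liftOp (cc a) + liftTheta a) * weyl n)).trace := by
  rw [charFun_eq, liftOp_mul, liftOp_mul, mul_assoc, mul_assoc, trace_liftOp_mul_comm,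
    mul_assoc, mul_assoc, weyl_mul_liftOp, mul_assoc]

theorem charFun_left (a b : Idx n) (ρ : Op n) :
    charFun (cc a * cc b * ρ)
      = (liftOp ρ * ((liftOp (cc a) + liftTheta a) * (liftOp (cc b) + liftTheta b)
          * weyl n)).trace := by
  rw [charFun_eq, liftOp_mul, mul_assoc, trace_liftOp_mul_comm, liftOp_mul, mul_assoc,
    ← mul_assoc (weyl n), weyl_mul_liftOp, mul_assoc (_ + _), weyl_mul_liftOp]
  simp only [mul_assoc]

theorem charFun_right (a b : Idx n) (ρ : Op n) :
    charFun (ρ * (cc a * cc b))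
      = (liftOp ρ * (liftOp (cc a) * liftOp (cc b) * weyl n)).trace := by
  rw [charFun_eq, liftOp_mul, liftOp_mul, mul_assoc]

end CARGrass

/-! ### Evolution of the characteristic function -/

section CharFunEvolution
variable {n : ℕ}

/-- The matrix `-iH - (Γ^T + Γ)/2`. -/
noncomputable def driftForm (H Γ : Mat n) : Mat n :=
  -Complex.I • H - (1 / 2 : ℂ) • (Γᵀ + Γ)

/-- The functional `Y ↦ tr (ρ Y e^{𝛉^T E 𝔠})`. -/
noncomputable def weylTrace (ρ : Op n) : CARGrass n →ₗ[ℂ] Grass n :=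
  Matrix.traceLinearMap (Conf n) ℂ (Grass n) ∘ₗ LinearMap.mulLeft ℂ (liftOp ρ)
    ∘ₗ LinearMap.mulRight ℂ (weyl n)

theorem weylTrace_apply (ρ : Op n) (Y : CARGrass n) :
    weylTrace ρ Y = (liftOp ρ * (Y * weyl n)).trace := rfl

/-- The characteristic function as a linear map. -/
noncomputable def charFunLinear (n : ℕ) : Op n →ₗ[ℂ] Grass n where
  toFun := charFun
  map_add' ρ ρ' := by
    rw [charFun_eq, charFun_eq, charFun_eq, liftOp_add, add_mul, trace_add]
  map_smul' r ρ := by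
    rw [charFun_eq, charFun_eq, liftOp_smul, smul_mul_assoc, trace_smul]
    rfl

theorem charFunLinear_apply (ρ : Op n) : charFunLinear n ρ = charFun ρ := rfl

theorem charFun_quadForm_mul (K : Mat n) (ρ : Op n) :
    charFunLinear n (quadForm K * ρ) = weylTrace ρ (∑ a, ∑ b, K a b •
      ((liftOp (cc a) + liftTheta a) * (liftOp (cc b) + liftTheta b))) := by
  simp only [quadForm, Finset.sum_mul, smul_mul_assoc, map_sum, map_smul, charFunLinear_apply,
    charFun_left, weylTrace_apply]

theorem charFun_mul_quadForm (K : Mat n) (ρ : Op n) :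
    charFunLinear n (ρ * quadForm K) = weylTrace ρ (∑ a, ∑ b, K a b •
      (liftOp (cc a) * liftOp (cc b))) := by
  simp only [quadForm, Finset.mul_sum, mul_smul_comm, map_sum, map_smul, charFunLinear_apply,
    charFun_right, weylTrace_apply]

theorem charFun_jump_sum (K : Mat n) (ρ : Op n) :
    charFunLinear n (∑ a, ∑ b, K a b • (cc a * ρ * cc b)) = weylTrace ρ (∑ a, ∑ b, K a b •
      (liftOp (cc b) * (liftOp (cc a) + liftTheta a))) := by
  simp only [map_sum, map_smul, charFunLinear_apply, charFun_jump, weylTrace_apply]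

theorem mixedForm_add (M N : Mat n) : mixedForm (M + N) = mixedForm M + mixedForm N := by
  simp only [mixedForm, Matrix.add_apply, add_smul, Finset.sum_add_distrib]

theorem mixedForm_smul (r : ℂ) (M : Mat n) : mixedForm (r • M) = r • mixedForm M := by
  simp only [mixedForm, Matrix.smul_apply, smul_assoc, Finset.smul_sum]

theorem hamiltonian_symbol {H : Mat n} (hH : Hᵀ = -H) :
    ∑ a, ∑ b, H a b • ((liftOp (cc a) + liftTheta a) * (liftOp (cc b) + liftTheta b))
        - ∑ a, ∑ b, H a b • (liftOp (cc a) * liftOp (cc b))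
      = (2 : ℂ) • (mixedForm H + gmul (quadTheta H) 1) := by
  have h1 : ∑ a, ∑ b, H a b • (liftOp (cc a) * liftTheta b) = mixedForm H := by
    rw [mixedForm, Finset.sum_comm]
    refine Finset.sum_congr rfl fun a _ => Finset.sum_congr rfl fun b _ => ?_
    rw [liftOp_mul_liftTheta, ← transpose_apply H, hH, Matrix.neg_apply, smul_neg, neg_smul,
      neg_neg]
  have h2 : ∑ a, ∑ b, H a b • (liftTheta a * liftOp (cc b)) = mixedForm H := rfl
  simp only [add_mul, mul_add, smul_add, Finset.sum_add_distrib, h1, h2, gmul_quadTheta, smul_smul]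
  module

/-- The jump term cancels the two halves of the anticommutator in the terms without `θ`, so only
terms of degree at most one in `𝔠` remain. -/
theorem dissipator_symbol (Γ : Mat n) :
    ∑ a, ∑ b, Γ a b • (liftOp (cc b) * (liftOp (cc a) + liftTheta a))
        - (1 / 2 : ℂ) • ∑ a, ∑ b, Γᵀ a b •
          ((liftOp (cc a) + liftTheta a) * (liftOp (cc b) + liftTheta b))
        - (1 / 2 : ℂ) • ∑ a, ∑ b, Γᵀ a b • (liftOp (cc a) * liftOp (cc b))
      = (-1 / 2 : ℂ) • (mixedForm Γ + mixedForm Γᵀ) - gmul (quadTheta Γᵀ) 1 := by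
  have h0 : ∑ a, ∑ b, Γ a b • (liftOp (cc b) * (liftOp (cc a) + liftTheta a))
      = ∑ a, ∑ b, Γᵀ a b • (liftOp (cc a) * (liftOp (cc b) + liftTheta b)) := Finset.sum_comm
  have h1 : ∑ a, ∑ b, Γᵀ a b • (liftOp (cc a) * liftTheta b) = -mixedForm Γ := by
    rw [mixedForm, Finset.sum_comm, ← Finset.sum_neg_distrib]
    refine Finset.sum_congr rfl fun a _ => ?_
    rw [← Finset.sum_neg_distrib]
    refine Finset.sum_congr rfl fun b _ => ?_
    rw [liftOp_mul_liftTheta, transpose_apply, smul_neg]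
  have h2 : ∑ a, ∑ b, Γᵀ a b • (liftTheta a * liftOp (cc b)) = mixedForm Γᵀ := rfl
  rw [h0]
  simp only [add_mul, mul_add, smul_add, Finset.sum_add_distrib, h1, h2, gmul_quadTheta]
  module

theorem gmul_add_left (ω ω' : Grass n) (X : Op n) : gmul (ω + ω') X = gmul ω X + gmul ω' X := by
  ext x y; simp [gmul_apply]

theorem gmul_smul_left (r : ℂ) (ω : Grass n) (X : Op n) : gmul (r • ω) X = r • gmul ω X := by
  ext x y
  exact smul_comm (X x y) r ω

/-- The total `𝛉`-quadratic symbol is that of `-iH - Γᵀ`. The derivation accounts for `-iH - (Γᵀ +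
Γ)/2`, and the remainder `(Γ - Γᵀ)/2` acts by multiplication. -/
theorem charFun_quadGen {H : Mat n} (Γ : Mat n) (hH : Hᵀ = -H) (ρ : Op n) :
    charFun (quadGen H Γ 0 ρ)
      = grassDeriv (driftForm H Γ * matE n) (charFun ρ)
        + quadTheta ((1 / 2 : ℂ) • (Γ - Γᵀ)) * charFun ρ := by
  have hE : driftForm H Γ * matE n * matE n = driftForm H Γ := by
    rw [Matrix.mul_assoc, matE_mul_self, Matrix.mul_one]
  have hL : quadGen H Γ 0 ρ = (-Complex.I / 2) • (quadForm H * ρ - ρ * quadForm H)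
      + (∑ i, ∑ j, Γ i j • (cc i * ρ * cc j) - (1 / 2 : ℂ) • (quadForm Γᵀ * ρ)
        - (1 / 2 : ℂ) • (ρ * quadForm Γᵀ)) := by
    simp only [quadGen, LinearMap.coe_mk, AddHom.coe_mk, linForm_zero, add_zero, Matrix.smul_mul,
      Matrix.mul_smul]
    module
  rw [grassDeriv_charFun, hE, ← trace_liftOp_gmul, ← weylTrace_apply, ← weylTrace_apply, ← map_add,
    ← charFunLinear_apply, hL]
  simp only [map_add, map_sub, map_smul, charFun_quadForm_mul, charFun_mul_quadForm,
    charFun_jump_sum]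
  simp only [← map_add, ← map_sub, ← map_smul]
  congr 1
  rw [hamiltonian_symbol hH, dissipator_symbol]
  have e1 : driftForm H Γ = (-Complex.I) • H + (-1 / 2 : ℂ) • Γᵀ + (-1 / 2 : ℂ) • Γ := by
    rw [driftForm]; module
  have e2 : (1 / 2 : ℂ) • (Γ - Γᵀ) = (1 / 2 : ℂ) • Γ + (-1 / 2 : ℂ) • Γᵀ := by module
  rw [e1, e2]
  simp only [mixedForm_add, mixedForm_smul, quadTheta_add, quadTheta_smul, gmul_add_left,
    gmul_smul_left]
  module

end CharFunEvolution

/-! ### Even Gaussian states are preserved -/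

section ExpDeriv

theorem hasDerivAt_pow_succ_of_commute {A : Type*} [NormedRing A] [NormedAlgebra ℝ A] {y : ℝ → A}
    {y' : A} {t : ℝ} (hy : HasDerivAt y y' t) (hc : Commute (y t) y') (k : ℕ) :
    HasDerivAt (fun s => y s ^ (k + 1)) (((k + 1 : ℕ) : ℝ) • (y' * y t ^ k)) t := by
  induction k with
  | zero => simpa using hy
  | succ k ih =>
    simp only [pow_succ _ (k + 1)]
    refine (ih.mul hy).congr_deriv ?_
    rw [(hc.pow_left (k + 1)).eq, smul_mul_assoc, mul_assoc, ← pow_succ]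
    push_cast
    module

theorem hasDerivAt_nilpotentExp {A : Type*} [NormedRing A] [NormedAlgebra ℝ A] [Module ℚ A]
    {y : ℝ → A} {y' : A} {t : ℝ} (hy : HasDerivAt y y' t) (hc : Commute (y t) y') {N : ℕ}
    (hN : ∀ s, y s ^ N = 0) :
    HasDerivAt (fun s => IsNilpotent.exp (y s)) (y' * IsNilpotent.exp (y t)) t := by
  have hN1 : ∀ s, y s ^ (N + 1) = 0 := fun s => by rw [pow_succ, hN, zero_mul]
  have hq : ∀ (k : ℕ) (x : A), ((k.factorial : ℚ)⁻¹) • x = ((k.factorial : ℝ)⁻¹) • x :=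
    fun k x => by
    rw [← Rat.cast_smul_eq_qsmul ℝ]
    norm_num
  have he : (fun s => IsNilpotent.exp (y s))
      = fun s => ∑ k ∈ Finset.range N, ((k + 1).factorial : ℝ)⁻¹ • y s ^ (k + 1) + 1 := by
    funext s
    rw [IsNilpotent.exp_eq_sum (hN1 s), Finset.sum_range_succ']
    simp only [hq]
    simp
  rw [he, IsNilpotent.exp_eq_sum (hN t), Finset.mul_sum]
  refine ((HasDerivAt.fun_sum fun k _ => (hasDerivAt_pow_succ_of_commute hy hc k).const_smul
    (((k + 1).factorial : ℝ)⁻¹)).add_const 1).congr_deriv ?_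
  refine Finset.sum_congr rfl fun k _ => ?_
  have hk : (k.factorial : ℝ) ≠ 0 := by positivity
  rw [hq, smul_smul, mul_smul_comm, Nat.factorial_succ]
  congr 1
  push_cast
  field_simp

end ExpDeriv

/-! ### Differentiation in the Grassmann algebra and the Gaussian solution -/

section Gaussian
open scoped Matrix.Norms.L2Operator
variable {n : ℕ}

instance finiteDimensional_grass : FiniteDimensional ℂ (Grass n) := by
  classical
  let _ : LinearOrder (Idx n) := linearOrderOfSTO WellOrderingRel
  exact Module.Finite.of_basis (Pi.basisFun ℂ (Idx n)).ExteriorAlgebra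

/-- The regular representation of the Grassmann algebra. -/
noncomputable def grassRep (n : ℕ) : Grass n →ₐ[ℂ]
    Matrix (Fin (Module.finrank ℂ (Grass n))) (Fin (Module.finrank ℂ (Grass n))) ℂ :=
  Algebra.leftMulMatrix (Module.finBasis ℂ (Grass n))

theorem grassRep_injective : Function.Injective (grassRep n) :=
  Algebra.leftMulMatrix_injective _

/-- The operator norm of the regular representation. -/
noncomputable abbrev grassNormedRing (n : ℕ) : NormedRing (Grass n) :=
  NormedRing.induced _ _ (grassRep n) grassRep_injective

attribute [local instance] grassNormedRing

/-- The Grassmann algebra is a normed algebra. -/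
noncomputable abbrev grassNormedAlgebra (n : ℕ) : NormedAlgebra ℂ (Grass n) :=
  NormedAlgebra.induced ℂ _ _ (grassRep n)

attribute [local instance] grassNormedAlgebra

/-- The quadratic form `𝛉^T K 𝛉 / 2` as a linear function of `K`. -/
noncomputable def quadThetaLinear (n : ℕ) : Mat n →ₗ[ℂ] Grass n where
  toFun := quadTheta
  map_add' := quadTheta_add
  map_smul' := quadTheta_smul

theorem hasDerivAt_gaussExp {K : ℝ → Mat n} {K' : Mat n} {t : ℝ} (hK : HasDerivAt K K' t) :
    HasDerivAt (fun s => gaussExp (K s)) (quadTheta K' * gaussExp (K t)) t := by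
  have h : HasDerivAt (fun s => quadTheta (K s)) (quadTheta K') t :=
    ((LinearMap.toContinuousLinearMap (quadThetaLinear n)).restrictScalars
      ℝ).hasFDerivAt.comp_hasDerivAt t hK
  exact hasDerivAt_nilpotentExp h (quadTheta_commute _ _) fun s => quadTheta_pow (K s)

/-- The generator of the evolution of characteristic functions. -/
noncomputable def charGen (H Γ : Mat n) : Grass n →ₗ[ℂ] Grass n :=
  grassDeriv (driftForm H Γ * matE n) + LinearMap.mulLeft ℂ (quadTheta ((1 / 2 : ℂ) • (Γ - Γᵀ)))

theorem hasDerivAt_charFun {H : Mat n} (Γ : Mat n) (hH : Hᵀ = -H) (ρ : Op n) (t : ℝ) :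
    HasDerivAt (fun s => charFun (superExp (quadGen H Γ 0) s ρ))
      (charGen H Γ (charFun (superExp (quadGen H Γ 0) t ρ))) t :=
  (((LinearMap.toContinuousLinearMap (charFunLinear n)).restrictScalars
    ℝ).hasFDerivAt.comp_hasDerivAt t (hasDerivAt_superExp (quadGen H Γ 0) ρ t)).congr_deriv
    (charFun_quadGen Γ hH _)

/-- The evolution of the matrix `K` of an even Gaussian state. -/
noncomputable def evolveForm (H Γ K : Mat n) (t : ℝ) : Mat n :=
  -(matE n * evolve H Γ (-(matE n * K * matE n)) t * matE n)

theorem evolveForm_zero {H : Mat n} (Γ K : Mat n) (hH : Hᵀ = -H) : evolveForm H Γ K 0 = K := by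
  have h : matE n * (matE n * K) = K := by rw [← Matrix.mul_assoc, matE_mul_self, Matrix.one_mul]
  rw [evolveForm, evolve_zero Γ _ hH, Matrix.mul_neg, Matrix.neg_mul, neg_neg,
    Matrix.mul_assoc (matE n) K, ← Matrix.mul_assoc (matE n) (matE n), matE_mul_self,
    Matrix.one_mul, Matrix.mul_assoc, matE_mul_self, Matrix.mul_one]

/-- The substitution `K = -EAE` carries the Lyapunov equation for `A` into the one that a Gaussian
ansatz requires of `K`. -/
theorem hasDerivAt_evolveForm {H : Mat n} (Γ K : Mat n) (hH : Hᵀ = -H) (t : ℝ) :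
    HasDerivAt (evolveForm H Γ K)
      (driftForm H Γ * matE n * evolveForm H Γ K t
        + evolveForm H Γ K t * (driftForm H Γ * matE n)ᵀ + (1 / 2 : ℂ) • (Γ - Γᵀ)) t := by
  have h := (((hasDerivAt_evolve Γ (-(matE n * K * matE n)) hH t).const_mul (matE n)).mul_const
    (matE n)).neg
  refine h.congr_deriv ?_
  have e1 : drift H Γ = matE n * driftForm H Γ := rfl
  have e2 : ∀ Y : Mat n, matE n * (matE n * Y) = Y := fun Y => by
    rw [← Matrix.mul_assoc, matE_mul_self, Matrix.one_mul]
  simp only [evolveForm, e1, noise, transpose_mul, matE_transpose, Matrix.mul_add, Matrix.add_mul,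
    Matrix.mul_assoc, e2, matE_mul_self, Matrix.mul_one, Matrix.mul_neg, Matrix.neg_mul]
  module

theorem charFun_superExp {H : Mat n} (Γ : Mat n) (hH : Hᵀ = -H) {ρ : Op n} {K : Mat n}
    (hK : charFun ρ = gaussExp K) (t : ℝ) :
    charFun (superExp (quadGen H Γ 0) t ρ) = gaussExp (evolveForm H Γ K t) := by
  have : FiniteDimensional ℝ (Grass n) := FiniteDimensional.complexToReal (Grass n)
  have h := linear_ode_unique ((charGen H Γ).restrictScalars ℝ) 0
    (f := fun s => charFun (superExp (quadGen H Γ 0) s ρ))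
    (g := fun s => gaussExp (evolveForm H Γ K s))
    (fun s => (hasDerivAt_charFun Γ hH ρ s).congr_deriv (add_zero _).symm)
    (fun s => (hasDerivAt_gaussExp (hasDerivAt_evolveForm Γ K hH s)).congr_deriv ?_)
    (by simp only [superExp_zero, evolveForm_zero Γ K hH, hK])
  · exact congrFun h t
  · rw [add_zero, LinearMap.restrictScalars_apply, charGen, LinearMap.add_apply,
      LinearMap.mulLeft_apply, grassDeriv_gaussExp, quadTheta_add, add_mul]

theorem quadTheta_transpose (K : Mat n) : quadTheta Kᵀ = -quadTheta K := by
  simp only [quadTheta, ← smul_neg, ← Finset.sum_neg_distrib]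
  rw [Finset.sum_comm]
  refine congrArg _ (Finset.sum_congr rfl fun i _ => Finset.sum_congr rfl fun j _ => ?_)
  rw [transpose_apply, theta_mul_comm, smul_neg]

/-- Since the `θ`'s anticommute, only the antisymmetric part of `K` matters; this makes it
unnecessary to check that the evolved matrix stays antisymmetric. -/
theorem gaussExp_antisymm (K : Mat n) :
    ∃ K' : Mat n, K'ᵀ = -K' ∧ gaussExp K = gaussExp K' := by
  refine ⟨(1 / 2 : ℂ) • (K + (-1 : ℂ) • Kᵀ), ?_, ?_⟩
  · simp only [transpose_smul, transpose_add, transpose_transpose]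
    module
  · rw [gaussExp_eq, gaussExp_eq, quadTheta_smul, quadTheta_add, quadTheta_smul,
      quadTheta_transpose]
    congr 1
    module

theorem isEvenGaussian_superExp {H Γ : Mat n} (hH : Hᵀ = -H) {t : ℝ}
    (hch : IsChannel (superExp (quadGen H Γ 0) t)) {ρ : Op n} (hρ : IsEvenGaussian ρ) :
    IsEvenGaussian (superExp (quadGen H Γ 0) t ρ) := by
  obtain ⟨hd, K, -, hK⟩ := hρ
  obtain ⟨K', h1, h2⟩ := gaussExp_antisymm (evolveForm H Γ K t)
  exact ⟨hch.isDensity hd, K', h1, (charFun_superExp Γ hH hK t).trans h2⟩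

end Gaussian
end FermiGauss

theorem mainTheorem12 (n : ℕ) (H Γ : FermiGauss.Mat n)
    (hH : Hᵀ = -H) (hH' : FermiGauss.tildeConj H = -H)
    (hΓ : Γᵀ = FermiGauss.tildeConj Γ) (hΓE : (Γ * FermiGauss.matE n).PosSemidef)
    (hdet : (Complex.I • H - (1 / 2 : ℂ) • (Γᵀ + Γ)).det ≠ 0)
    (t : ℝ) (ht : 0 ≤ t) :
    FermiGauss.IsParityPreservingGaussianChannel
      (FermiGauss.superExp (FermiGauss.quadGen H Γ 0) t)
      (FermiGauss.pairG H Γ t) (FermiGauss.pairAlpha H Γ t) where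
  channel := FermiGauss.isChannel_superExp hH hH' hΓ hΓE ht
  parity_preserving := FermiGauss.parity_superExp H Γ t
  gaussian _ hρ :=
    FermiGauss.isEvenGaussian_superExp hH (FermiGauss.isChannel_superExp hH hH' hΓ hΓE ht) hρ
  moments _ hρ := FermiGauss.anticov_superExp Γ hH t hρ.2
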